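/- Consider the rank-$4$ tensor theory of a real field $\phi^{abcd}$ with symmetry $O(N)^4$ and the octahedron interaction $$g\,\phi^{a_1b_1c_1d_1}\phi^{a_1b_2c_2d_2}\phi^{a_2b_2c_1d_3}\phi^{a_2b_3c_3d_1}\phi^{a_3b_3c_2d_3}\phi^{a_3b_1c_3d_2},$$ whose six fields are labelled $1,\dots,6$ in this order. The four index positions are called colours. A vacuum diagram is either the $0$-cycle (a closed propagator without vertices), or a connected diagram formed from a finite non-empty set of interaction vertices by joining all their labelled fields in pairs by propagators. Let $v$ be the number of vertices, and let $f$ be the total number of closed index loops: for each colour $c$, the number of closed curves obtained by alternately following propagators and the contractions of the colour-$c$ indices inside the vertices; the $0$-cycle has $v=0$ and $f=4$. The diagram is proportional to $g^vN^f$. A $1$-cycle is a propagator that joins two fields of the same vertex. A diagram is called maximal if $f=4v+4$, that is, if it contributes at the leading order $N^4$ when $N\to\infty$ with $\lambda=gN^4$ fixed. An elementary melon consists of two interaction vertices $L$ and $R$ and a label $j\in\{1,\dots,6\}$: for each $i\neq j$ a propagator joins the field $i$ of $L$ to the field $i$ of $R$, and the fields $j$ of $L$ and $R$ are the two external fields.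 (The six choices of $j$ are related by permutations of the colours.) The melonic move replaces a propagator of a diagram, possibly that of the $0$-cycle, by an elementary melon. Then: 1. Every vacuum diagram satisfies $f\le 4v+4$; thus maximal diagrams are those that saturate this bound. 2. No maximal vacuum diagram contains a $1$-cycle. 3. A vacuum diagram is maximal if and only if it can be obtained from the $0$-cycle by a finite number (possibly zero) of melonic moves. In other words, the theory is melonic in the conventional sense, with the elementary melon as the only melonic move and no snails. -/

import Mathlib

namespace OctahedronModel

/-- The octahedron interaction of the rank-4 real tensor `φ^{abcd}` with symmetry `O(N)^4`,
`φ^{a₁b₁c₁d₁} φ^{a₁b₂c₂d₂} φ^{a₂b₂c₁d₃} φ^{a₂b₃c₃d₁} φ^{a₃b₃c₂d₃} φ^{a₃b₁c₃d₂}`.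
The six fields are labelled `0, …, 5` in this order; the four colours (red, green, blue, yellow)
are the four index positions. `partner c i` is the field whose colour-`c` index is contracted
with the colour-`c` index of the field `i`, i.e. the neighbour of `i` along the colour-`c` edge of
the interaction graph. -/
def partner (c : Fin 4) : Fin 6 → Fin 6 :=
  (![![1, 0, 3, 2, 5, 4],
     ![5, 2, 1, 4, 3, 0],
     ![2, 4, 0, 5, 1, 3],
     ![3, 5, 4, 0, 2, 1]] : Fin 4 → Fin 6 → Fin 6) c

/-- Each colour is a perfect matching of the six fields. -/
theorem partner_partner (c : Fin 4) (i : Fin 6) : partner c (partner c i) = i := by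
  revert c i; decide

theorem partner_ne (c : Fin 4) (i : Fin 6) : partner c i ≠ i := by
  revert c i; decide

/-- A complete Wick contraction of the fields of a set `V` of octahedron vertices: the field
`(v, i)` (label `i` at the vertex `v`) is joined by a propagator to the field `w (v, i)`. -/
structure WickContraction (V : Type) where
  toFun : V × Fin 6 → V × Fin 6
  involutive : Function.Involutive toFun
  ne_self : ∀ x, toFun x ≠ x

namespace WickContraction

instance (V : Type) : CoeFun (WickContraction V) (fun _ => V × Fin 6 → V × Fin 6) :=
  ⟨WickContraction.toFun⟩

/-- Adjacency of distinct vertices in the single-line Feynman diagram (multiplicities of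
propagators, and propagators from a vertex to itself, play no role for connectedness). -/
def graph {V : Type} (w : WickContraction V) : SimpleGraph V :=
  SimpleGraph.fromRel (fun v v' => ∃ i j : Fin 6, w (v, i) = (v', j))

/-- The index lines of colour `c` in the multi-line diagram run through propagators and, inside
the vertices, from each field to its colour-`c` partner. -/
def LineStep {V : Type} (w : WickContraction V) (c : Fin 4) (x y : V × Fin 6) : Prop :=
  y = w x ∨ y = (x.1, partner c x.2)

/-- The number of closed index loops of colour `c`: the number of classes of the equivalence
relation generated by `LineStep`. -/
noncomputable def loopsOfColour {V : Type} (w : WickContraction V) (c : Fin 4) : ℕ :=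
  Nat.card (Quot (w.LineStep c))

/-- `w'` arises from `w` by replacing the propagator joining `x` and `w x` by the elementary melon
with external label `j`. The vertices of `w'` are those of `w` and two new vertices
`L = e (inr false)` and `R = e (inr true)`; for every label `i ≠ j` the fields `i` of `L` and `R`
are joined by a propagator, and the field `j` of `L` (of `R`) is joined to `x` (to `w x`). -/
structure IsMelonInsertion {V V' : Type} (w : WickContraction V) (w' : WickContraction V')
    (x : V × Fin 6) (j : Fin 6) (e : V ⊕ Bool ≃ V') : Prop where
  inner : ∀ i, i ≠ j → w' (e (Sum.inr false), i) = (e (Sum.inr true), i)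
  left : w' (e (Sum.inr false), j) = (e (Sum.inl x.1), x.2)
  right : w' (e (Sum.inr true), j) = (e (Sum.inl (w x).1), (w x).2)
  other : ∀ y, y ≠ x → y ≠ w x →
    w' (e (Sum.inl y.1), y.2) = (e (Sum.inl (w y).1), (w y).2)

end WickContraction

/-- Connected vacuum (free-energy) Feynman diagrams: the 0-cycle, i.e. the closed propagator
without any vertex, and the connected complete Wick contractions of a finite non-empty set of
octahedron vertices (`Connected` includes non-emptiness). -/
inductive VacuumDiagram : Type 1
  | zeroCycle : VacuumDiagram
  | ofContraction (V : Type) [Finite V] (w : WickContraction V) (conn : w.graph.Connected) :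
      VacuumDiagram

namespace VacuumDiagram

/-- The number of interaction vertices. -/
noncomputable def order : VacuumDiagram → ℕ
  | zeroCycle => 0
  | ofContraction V _ _ => Nat.card V

/-- The total number of index loops, `f_total`: the diagram is proportional to
`g ^ order * N ^ loops`. The 0-cycle has one loop of each of the four colours. -/
noncomputable def loops : VacuumDiagram → ℕ
  | zeroCycle => 4
  | ofContraction _ w _ => ∑ c : Fin 4, w.loopsOfColour c

/-- A diagram is maximal if it saturates the bound `f_total ≤ (r/4)(q-2) v + r`, with `r = 4` and
`q = 6`. With the 't Hooft coupling `λ = g N ^ 4` fixed, these are the diagrams of the leading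
order `N ^ 4`. -/
def IsMaximal (D : VacuumDiagram) : Prop :=
  D.loops = 4 * D.order + 4

/-- The single-line diagram contains a 1-cycle: a propagator joins two fields of one vertex. -/
def HasOneCycle : VacuumDiagram → Prop
  | zeroCycle => False
  | ofContraction _ w _ => ∃ v i j, w (v, i) = (v, j)

/-- The melonic move: `D'` is obtained from `D` by replacing one propagator by an elementary
melon. The elementary melon is the two-vertex diagram in which equally labelled fields are joined,
with the propagator between the two fields `j` cut open; the six choices of `j` are permuted
transitively by the colour permutations. Closing up a melon on the single propagator of the
0-cycle gives the two-vertex diagram itself, whatever `j` is. -/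
inductive MelonMove : VacuumDiagram → VacuumDiagram → Prop
  | onZeroCycle {V : Type} [Finite V] (w : WickContraction V) (conn : w.graph.Connected)
      (e : Bool ≃ V) (h : ∀ b i, w (e b, i) = (e (!b), i)) :
      MelonMove zeroCycle (ofContraction V w conn)
  | onPropagator {V V' : Type} [Finite V] [Finite V']
      (w : WickContraction V) (conn : w.graph.Connected)
      (w' : WickContraction V') (conn' : w'.graph.Connected)
      (x : V × Fin 6) (j : Fin 6) (e : V ⊕ Bool ≃ V') (h : w.IsMelonInsertion w' x j e) :
      MelonMove (ofContraction V w conn) (ofContraction V' w' conn')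

/-- Melonic diagrams: obtained from the 0-cycle by finitely many melonic moves. -/
def IsMelonic (D : VacuumDiagram) : Prop :=
  Relation.ReflTransGen MelonMove zeroCycle D

end VacuumDiagram

end OctahedronModel

namespace OctahedronModel

/-! Fix two colours and keep only their index lines. The fields, joined by propagators and by the
two matchings inside vertices, form a 3-edge-coloured graph, hence a closed, possibly non-orientable
surface whose faces are the bicoloured cycles. In the octahedron any two colours form a single
hexagon through all six fields, so with `v` vertices there are `6v` points, `9v` edges and `v`
hexagons, besides the index loops of the two colours. Euler characteristic at most 2 gives `f_c +
f_c' ≤ 2v + 2` (`two_mul_card_orb_le`), and splitting the four colours into two pairs gives the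
bound. Saturation makes all six surfaces spheres, with `v + 1` loops of each colour.

Spheres have no first homology modulo 2, and this is used twice. Their graphs are bipartite
(`exists_bipartition`); since any two labels are at even distance in some hexagon, 1-cycles are
impossible. Moreover every closed curve separates (`exists_face_potential`).

Counting fields along the loops of one colour produces a loop of two propagators, between vertices
`u` and `v`; parity shows that it joins the same two labels at both ends. Closing it through the
hexagons in various ways gives curves that together separate the four remaining labels of `u`
(`exists_separations`). If the two propagators were crossed, some region would be attached by a
single propagator, which is impossible because each vertex has six fields. Uncrossed, each remaining
label `m` either has a direct propagator from `u` to `v` or leads into a region attached only at the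
fields `m` of `u` and `v`.

Closing up such a region splits the diagram as a connected sum, and saturation passes to both
summands. Descending into regions yields an elementary melon (`Saturated.exists_melon`). Its removal
is again a connected sum decomposition, so induction on `v` finishes. Conversely, a melonic move is
a connected sum with the saturated two-vertex diagram. -/

/-- The orbits of the action generated by two maps. -/
abbrev Orb {X : Type} (a b : X → X) : Type := Quot (fun x y : X => y = a x ∨ y = b x)

/-- A fixed-point-free involution. -/
structure FPFInvolution {X : Type} (a : X → X) : Prop where
  inv : Function.Involutive a
  ne : ∀ x, a x ≠ x

/-! ### Homology modulo 2 of the surface of a 3-edge-coloured graph -/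

section Orbits

variable {X : Type} {a b w : X → X}

/-- The orbit of a point. -/
abbrev orb (a b : X → X) (x : X) : Orb a b := Quot.mk _ x

theorem orb_left (x : X) : orb a b (a x) = orb a b x := 
  (Quot.sound (r := fun x y : X => y = a x ∨ y = b x) (Or.inl rfl)).symm

theorem orb_right (x : X) : orb a b (b x) = orb a b x := 
  (Quot.sound (r := fun x y : X => y = a x ∨ y = b x) (Or.inr rfl)).symm

theorem orb_self_eq_iff (ha : Function.Involutive a) {x y : X} :
    orb a a y = orb a a x ↔ y = x ∨ y = a x := by
  constructor
  · intro h
    have := congrArg (Quot.lift (fun z => s(z, a z)) (by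
      rintro u v (rfl | rfl) <;> simp [ha u, Sym2.eq_swap])) h
    simp only [Sym2.eq_iff] at this
    tauto
  · rintro (rfl | rfl)
    · rfl
    · exact orb_left x

theorem sum_orb_self {M : Type} [AddCommMonoid M] [Fintype X] [Fintype (Orb a a)]
    (ha : FPFInvolution a) (f : Orb a a → M) :
    ∑ x, f (orb a a x) = 2 • ∑ e, f e := by
  classical
  rw [Finset.smul_sum, ← Finset.sum_fiberwise (s := Finset.univ) (g := orb a a)]
  refine Finset.sum_congr rfl fun e _ => ?_
  induction e using Quot.ind with
  | mk x =>
    have : Finset.univ.filter (fun y => orb a a y = orb a a x) = {x, a x} := by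
      ext y; simp [orb_self_eq_iff ha.inv]
    change ∑ y ∈ Finset.univ.filter (fun y => orb a a y = orb a a x), f (orb a a y) = _
    rw [this, Finset.sum_pair (ha.ne x).symm, orb_left, two_nsmul]

theorem two_mul_card_orb_self [Fintype X] [Fintype (Orb a a)] (ha : FPFInvolution a) :
    2 * Fintype.card (Orb a a) = Fintype.card X := by
  have := sum_orb_self ha (fun _ => 1)
  simp only [Finset.sum_const, Finset.card_univ, smul_eq_mul, mul_one] at this
  exact this.symm

/-- Connectedness of the graph generated by three maps. -/
def GenConnected (a b w : X → X) : Prop :=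
  ∀ A : Set X, A.Nonempty → (∀ x ∈ A, a x ∈ A ∧ b x ∈ A ∧ w x ∈ A) → ∀ x, x ∈ A

/-- The boundary map from edges to points, modulo 2. -/
def edgeBoundary (a b w : X → X) :
    ((Orb a a → ZMod 2) × (Orb b b → ZMod 2) × (Orb w w → ZMod 2)) →ₗ[ZMod 2] (X → ZMod 2) where
  toFun η x := η.1 (orb a a x) + η.2.1 (orb b b x) + η.2.2 (orb w w x)
  map_add' η θ := by ext x; simp; ring
  map_smul' r η := by ext x; simp; ring

theorem orb_map_left (a b : X → X) (x y : X) (h : y = a x ∨ y = a x) :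
    orb a b x = orb a b y := by
  rcases h with rfl | rfl <;> exact (orb_left x).symm

theorem orb_map_right (a b : X → X) (x y : X) (h : y = b x ∨ y = b x) :
    orb a b x = orb a b y := by
  rcases h with rfl | rfl <;> exact (orb_right x).symm

/-- The boundary map from bicoloured faces to edges, modulo 2. -/
def faceBoundary (a b w : X → X) :
    ((Orb a b → ZMod 2) × (Orb a w → ZMod 2) × (Orb b w → ZMod 2)) →ₗ[ZMod 2]
      ((Orb a a → ZMod 2) × (Orb b b → ZMod 2) × (Orb w w → ZMod 2)) where
  toFun φ :=
    (fun e => φ.1 (e.lift _ (orb_map_left a b)) + φ.2.1 (e.lift _ (orb_map_left a w)),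
     fun e => φ.1 (e.lift _ (orb_map_right a b)) + φ.2.2 (e.lift _ (orb_map_left b w)),
     fun e => φ.2.1 (e.lift _ (orb_map_right a w)) + φ.2.2 (e.lift _ (orb_map_right b w)))
  map_add' η θ := by ext x <;> simp <;> ring
  map_smul' r η := by ext x <;> simp <;> ring

/-- Each of the three faces at a point contains two of the three edges there, so its contributions
cancel modulo 2. -/
theorem range_faceBoundary_le :
    LinearMap.range (faceBoundary a b w) ≤ LinearMap.ker (edgeBoundary a b w) := by
  rintro _ ⟨φ, rfl⟩
  rw [LinearMap.mem_ker]
  ext x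
  simp only [edgeBoundary, faceBoundary, LinearMap.coe_mk, AddHom.coe_mk, Pi.zero_apply]
  have h2 : (2 : ZMod 2) = 0 := rfl
  linear_combination (φ.1 (orb a b x) + φ.2.1 (orb a w x) + φ.2.2 (orb b w x)) * h2

/-- A face chain without boundary takes equal values on the two sides of every edge. The three faces
at a point therefore agree, and connectedness makes the chain constant. -/
theorem finrank_ker_faceBoundary_le [Finite X] [Nonempty X] (hc : GenConnected a b w) :
    Module.finrank (ZMod 2) (LinearMap.ker (faceBoundary a b w)) ≤ 1 := by
  have : LinearMap.ker (faceBoundary a b w) ≤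
      Submodule.span (ZMod 2) {(1 : (Orb a b → ZMod 2) × (Orb a w → ZMod 2) × (Orb b w → ZMod 2))} := by
    rintro ⟨p, q, r⟩ h
    rw [LinearMap.mem_ker] at h
    simp only [faceBoundary, LinearMap.coe_mk, AddHom.coe_mk, Prod.mk_eq_zero] at h
    obtain ⟨h1, h2, h3⟩ := h
    have e1 : ∀ x, p (orb a b x) = q (orb a w x) := fun x =>
      CharTwo.add_eq_zero.1 (congrFun h1 (orb a a x))
    have e2 : ∀ x, p (orb a b x) = r (orb b w x) := fun x =>
      CharTwo.add_eq_zero.1 (congrFun h2 (orb b b x))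
    obtain ⟨x₀⟩ := ‹Nonempty X›
    have key := hc {x | p (orb a b x) = p (orb a b x₀)} ⟨x₀, rfl⟩ (by
      intro x hx
      refine ⟨?_, ?_, ?_⟩
      · simpa [orb_left] using hx
      · simpa [orb_right] using hx
      · change _ = _
        rw [e1, orb_right, ← e1]; exact hx)
    rw [Submodule.mem_span_singleton]
    refine ⟨p (orb a b x₀), ?_⟩
    ext e
    · induction e using Quot.ind with | mk x => simpa using (key x).symm
    · induction e using Quot.ind with | mk x => simpa [← e1] using (key x).symm
    · induction e using Quot.ind with | mk x => simpa [← e2] using (key x).symm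
  refine (Submodule.finrank_mono this).trans ?_
  refine (finrank_span_le_card _).trans ?_
  simp

open Classical in
theorem edgeBoundary_single_fst (ha : FPFInvolution a) (x : X) :
    edgeBoundary a b w (Pi.single (orb a a x) 1, 0, 0) = Pi.single x 1 + Pi.single (a x) 1 := by
  ext y
  simp only [edgeBoundary, LinearMap.coe_mk, AddHom.coe_mk, Pi.zero_apply, add_zero, Pi.add_apply,
    Pi.single_apply, orb_self_eq_iff ha.inv]
  by_cases h1 : y = x
  · subst h1; simp [(ha.ne y).symm]
  · simp [h1]

open Classical in
theorem edgeBoundary_single_snd (hb : FPFInvolution b) (x : X) :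
    edgeBoundary a b w (0, Pi.single (orb b b x) 1, 0) = Pi.single x 1 + Pi.single (b x) 1 := by
  ext y
  simp only [edgeBoundary, LinearMap.coe_mk, AddHom.coe_mk, Pi.zero_apply, add_zero, zero_add,
    Pi.add_apply, Pi.single_apply, orb_self_eq_iff hb.inv]
  by_cases h1 : y = x
  · subst h1; simp [(hb.ne y).symm]
  · simp [h1]

open Classical in
theorem edgeBoundary_single_thd (hw : FPFInvolution w) (x : X) :
    edgeBoundary a b w (0, 0, Pi.single (orb w w x) 1) = Pi.single x 1 + Pi.single (w x) 1 := by
  ext y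
  simp only [edgeBoundary, LinearMap.coe_mk, AddHom.coe_mk, Pi.zero_apply, zero_add,
    Pi.add_apply, Pi.single_apply, orb_self_eq_iff hw.inv]
  by_cases h1 : y = x
  · subst h1; simp [(hw.ne y).symm]
  · simp [h1]

/-- Adjacent points differ by a boundary, so by connectedness one point generates the cokernel. -/
theorem card_le_finrank_range_edgeBoundary [Fintype X] [Nonempty X] (ha : FPFInvolution a)
    (hb : FPFInvolution b) (hw : FPFInvolution w) (hc : GenConnected a b w) :
    Fintype.card X ≤ Module.finrank (ZMod 2) (LinearMap.range (edgeBoundary a b w)) + 1 := by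
  classical
  obtain ⟨x₀⟩ := ‹Nonempty X›
  set W := LinearMap.range (edgeBoundary a b w) ⊔
    Submodule.span (ZMod 2) {(Pi.single x₀ 1 : X → ZMod 2)} with hW
  have step : ∀ x y : X, (Pi.single x 1 + Pi.single y 1 : X → ZMod 2) ∈
      LinearMap.range (edgeBoundary a b w) → (Pi.single x 1 : X → ZMod 2) ∈ W →
      (Pi.single y 1 : X → ZMod 2) ∈ W := by
    intro x y h hx
    have := W.sub_mem (Submodule.mem_sup_left (S := LinearMap.range (edgeBoundary a b w)) h) hx
    simpa using this
  have all : ∀ x, (Pi.single x 1 : X → ZMod 2) ∈ W := by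
    refine hc {x | (Pi.single x 1 : X → ZMod 2) ∈ W} ⟨x₀, ?_⟩ fun x hx => ⟨?_, ?_, ?_⟩
    · exact Submodule.mem_sup_right (Submodule.mem_span_singleton_self _)
    · exact step x _ ⟨_, edgeBoundary_single_fst ha x⟩ hx
    · exact step x _ ⟨_, edgeBoundary_single_snd hb x⟩ hx
    · exact step x _ ⟨_, edgeBoundary_single_thd hw x⟩ hx
  have top : W = ⊤ := by
    rw [eq_top_iff]
    intro f _
    rw [pi_eq_sum_univ' f]
    refine W.sum_mem fun i _ => ?_
    refine W.smul_mem _ ?_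
    convert all i using 1
  have h1 := Submodule.finrank_add_le_finrank_add_finrank
    (LinearMap.range (edgeBoundary a b w)) (Submodule.span (ZMod 2) {(Pi.single x₀ 1 : X → ZMod 2)})
  rw [← hW, top, finrank_top, Module.finrank_fintype_fun_eq_card] at h1
  have h2 := finrank_span_le_card (R := ZMod 2) {(Pi.single x₀ 1 : X → ZMod 2)}
  simp only [Set.toFinset_singleton, Finset.card_singleton] at h2
  omega

theorem finrank_edges_eq [Fintype X] (ha : FPFInvolution a) (hb : FPFInvolution b)
    (hw : FPFInvolution w) :
    2 * Module.finrank (ZMod 2) ((Orb a a → ZMod 2) × (Orb b b → ZMod 2) × (Orb w w → ZMod 2)) =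
      3 * Fintype.card X := by
  classical
  have := Fintype.ofFinite (Orb a a)
  have := Fintype.ofFinite (Orb b b)
  have := Fintype.ofFinite (Orb w w)
  simp only [Module.finrank_prod, Module.finrank_fintype_fun_eq_card]
  have := two_mul_card_orb_self ha
  have := two_mul_card_orb_self hb
  have := two_mul_card_orb_self hw
  omega

theorem finrank_faces_eq [Finite X] :
    Module.finrank (ZMod 2) ((Orb a b → ZMod 2) × (Orb a w → ZMod 2) × (Orb b w → ZMod 2)) =
      Nat.card (Orb a b) + Nat.card (Orb a w) + Nat.card (Orb b w) := by
  classical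
  have := Fintype.ofFinite (Orb a b)
  have := Fintype.ofFinite (Orb a w)
  have := Fintype.ofFinite (Orb b w)
  simp only [Module.finrank_prod, Module.finrank_fintype_fun_eq_card, Nat.card_eq_fintype_card]
  omega

/-- The Euler characteristic of a connected closed surface is at most two. -/
theorem two_mul_card_orb_le [Finite X] [Nonempty X] (ha : FPFInvolution a)
    (hb : FPFInvolution b) (hw : FPFInvolution w) (hc : GenConnected a b w) :
    2 * (Nat.card (Orb a b) + Nat.card (Orb a w) + Nat.card (Orb b w)) ≤ Nat.card X + 4 := by
  have := Fintype.ofFinite X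
  -- With `F` faces and `E` edges, `F - 1 ≤ dim im ∂₂ ≤ dim ker ∂₁ ≤ E - (|X| - 1)` and `2E = 3|X|`.
  have h1 := (faceBoundary a b w).finrank_range_add_finrank_ker
  have h2 := (edgeBoundary a b w).finrank_range_add_finrank_ker
  have h3 := Submodule.finrank_mono (range_faceBoundary_le (a := a) (b := b) (w := w))
  have h4 := finrank_ker_faceBoundary_le hc
  have h5 := card_le_finrank_range_edgeBoundary ha hb hw hc
  have h6 := finrank_edges_eq ha hb hw
  rw [finrank_faces_eq] at h1
  rw [Nat.card_eq_fintype_card (α := X)]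
  omega

/-- On a sphere every cycle modulo 2 is a boundary. -/
theorem ker_edgeBoundary_eq_range [Finite X] [Nonempty X] (ha : FPFInvolution a)
    (hb : FPFInvolution b) (hw : FPFInvolution w) (hc : GenConnected a b w)
    (hs : 2 * (Nat.card (Orb a b) + Nat.card (Orb a w) + Nat.card (Orb b w)) = Nat.card X + 4) :
    LinearMap.range (faceBoundary a b w) = LinearMap.ker (edgeBoundary a b w) := by
  have := Fintype.ofFinite X
  have h1 := (faceBoundary a b w).finrank_range_add_finrank_ker
  have h2 := (edgeBoundary a b w).finrank_range_add_finrank_ker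
  have h4 := finrank_ker_faceBoundary_le hc
  have h5 := card_le_finrank_range_edgeBoundary ha hb hw hc
  have h6 := finrank_edges_eq ha hb hw
  rw [finrank_faces_eq] at h1
  rw [Nat.card_eq_fintype_card (α := X)] at hs
  exact Submodule.eq_of_le_of_finrank_le range_faceBoundary_le (by omega)

/-- A cycle on the sphere separates its faces into two classes. -/
theorem exists_face_potential [Finite X] [Nonempty X] (ha : FPFInvolution a)
    (hb : FPFInvolution b) (hw : FPFInvolution w) (hc : GenConnected a b w)
    (hs : 2 * (Nat.card (Orb a b) + Nat.card (Orb a w) + Nat.card (Orb b w)) = Nat.card X + 4)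
    (α β γ : X → ZMod 2) (hα : ∀ x, α (a x) = α x) (hβ : ∀ x, β (b x) = β x)
    (hγ : ∀ x, γ (w x) = γ x) (h0 : ∀ x, α x + β x + γ x = 0) :
    ∃ p q r : X → ZMod 2, (∀ x, p (a x) = p x ∧ p (b x) = p x) ∧
      (∀ x, q (a x) = q x ∧ q (w x) = q x) ∧ (∀ x, r (b x) = r x ∧ r (w x) = r x) ∧
      ∀ x, p x + q x = α x ∧ p x + r x = β x ∧ q x + r x = γ x := by
  have hmem : ((Quot.lift α (by rintro x y (rfl | rfl) <;> simp [hα]),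
      Quot.lift β (by rintro x y (rfl | rfl) <;> simp [hβ]),
      Quot.lift γ (by rintro x y (rfl | rfl) <;> simp [hγ])) :
      (Orb a a → ZMod 2) × (Orb b b → ZMod 2) × (Orb w w → ZMod 2)) ∈
      LinearMap.range (faceBoundary a b w) := by
    rw [ker_edgeBoundary_eq_range ha hb hw hc hs, LinearMap.mem_ker]
    ext x
    exact h0 x
  obtain ⟨φ, hφ⟩ := hmem
  simp only [faceBoundary, LinearMap.coe_mk, AddHom.coe_mk, Prod.mk.injEq] at hφ
  obtain ⟨e1, e2, e3⟩ := hφ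
  refine ⟨fun x => φ.1 (orb a b x), fun x => φ.2.1 (orb a w x), fun x => φ.2.2 (orb b w x),
    fun x => ⟨?_, ?_⟩, fun x => ⟨?_, ?_⟩, fun x => ⟨?_, ?_⟩, fun x => ⟨?_, ?_, ?_⟩⟩
  · simp only [orb_left]
  · simp only [orb_right]
  · simp only [orb_left]
  · simp only [orb_right]
  · simp only [orb_left]
  · simp only [orb_right]
  · exact congrFun e1 (orb a a x)
  · exact congrFun e2 (orb b b x)
  · exact congrFun e3 (orb w w x)

/-- A bicoloured face has equally many edges of its two colours, each being half the number of its
points. Halving is not possible modulo 2, so the count is made with representatives in `ℕ`. -/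
theorem sum_orb_self_comp [Fintype X] [Fintype (Orb a a)] [Fintype (Orb b b)]
    (ha : FPFInvolution a) (hb : FPFInvolution b) (f : Orb a b → ZMod 2) :
    ∑ e : Orb a a, f (e.lift _ (orb_map_left a b)) =
      ∑ e : Orb b b, f (e.lift _ (orb_map_right a b)) := by
  have h1 := sum_orb_self ha (fun e => (f (e.lift _ (orb_map_left a b))).val)
  have h2 := sum_orb_self hb (fun e => (f (e.lift _ (orb_map_right a b))).val)
  have h3 : ∑ e : Orb a a, (f (e.lift _ (orb_map_left a b))).val =
      ∑ e : Orb b b, (f (e.lift _ (orb_map_right a b))).val := by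
    have := h1.symm.trans h2
    simpa using this
  have := congrArg (Nat.cast : ℕ → ZMod 2) h3
  simpa using this

/-- The graph of a sphere built from bicoloured faces is bipartite. -/
theorem exists_bipartition [Finite X] [Nonempty X] (ha : FPFInvolution a)
    (hb : FPFInvolution b) (hw : FPFInvolution w) (hc : GenConnected a b w)
    (hs : 2 * (Nat.card (Orb a b) + Nat.card (Orb a w) + Nat.card (Orb b w)) = Nat.card X + 4) :
    ∃ ε : X → ZMod 2, ∀ x, ε (a x) = ε x + 1 ∧ ε (b x) = ε x + 1 ∧ ε (w x) = ε x + 1 := by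
  classical
  have := Fintype.ofFinite X
  have := Fintype.ofFinite (Orb a a)
  have := Fintype.ofFinite (Orb b b)
  have := Fintype.ofFinite (Orb w w)
  let S : Module.Dual (ZMod 2)
      ((Orb a a → ZMod 2) × (Orb b b → ZMod 2) × (Orb w w → ZMod 2)) :=
    { toFun := fun η => ∑ e, η.1 e + ∑ e, η.2.1 e + ∑ e, η.2.2 e
      map_add' := fun η θ => by simp [Finset.sum_add_distrib]; ring
      map_smul' := fun r η => by simp [Finset.mul_sum, mul_add] }
  -- Faces have even length, so the edge count vanishes on boundaries, hence on all cycles, and thus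
  -- factors through `edgeBoundary`. The factor, evaluated at single points, is the bipartition.
  have hS : S ∈ LinearMap.range (edgeBoundary a b w).dualMap := by
    rw [LinearMap.range_dualMap_eq_dualAnnihilator_ker, Submodule.mem_dualAnnihilator,
      ← ker_edgeBoundary_eq_range ha hb hw hc hs]
    rintro _ ⟨φ, rfl⟩
    simp only [S, faceBoundary, LinearMap.coe_mk, AddHom.coe_mk, Finset.sum_add_distrib]
    rw [sum_orb_self_comp ha hb, sum_orb_self_comp ha hw, sum_orb_self_comp hb hw]
    have h2 : (2 : ZMod 2) = 0 := rfl
    linear_combination (∑ e : Orb b b, φ.1 (e.lift _ (orb_map_right a b)) +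
      ∑ e : Orb w w, φ.2.1 (e.lift _ (orb_map_right a w)) +
      ∑ e : Orb w w, φ.2.2 (e.lift _ (orb_map_right b w))) * h2
  obtain ⟨l, hl⟩ := hS
  have key : ∀ u v : ZMod 2, u + v = 1 → v = u + 1 := by decide
  refine ⟨fun x => l (Pi.single x 1), fun x => ⟨key _ _ ?_, key _ _ ?_, key _ _ ?_⟩⟩
  · rw [← map_add, ← edgeBoundary_single_fst (b := b) (w := w) ha, ← LinearMap.dualMap_apply, hl]
    simp [S]
  · rw [← map_add, ← edgeBoundary_single_snd (a := a) (w := w) hb, ← LinearMap.dualMap_apply, hl]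
    simp [S]
  · rw [← map_add, ← edgeBoundary_single_thd (a := a) (b := b) hw, ← LinearMap.dualMap_apply, hl]
    simp [S]

end Orbits

/-! ### Parity of sets paired by an involution -/

section Parity

variable {X : Type}

theorem even_card_of_fpfInvolution {a : X → X} (ha : FPFInvolution a) (A : Finset X)
    (h : ∀ x ∈ A, a x ∈ A) : Even A.card := by
  have : ∑ x ∈ A, (1 : ZMod 2) = 0 :=
    Finset.sum_involution (fun x _ => a x) (fun _ _ => by decide) (fun x _ _ => ha.ne x)
      (fun x hx => h x hx) (fun x _ => ha.inv x)
  rw [← ZMod.natCast_eq_zero_iff_even]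
  simpa using this

/-- A set of points of even size cannot have exactly one outgoing edge. -/
theorem mem_of_even_card {w : X → X} (hw : FPFInvolution w) (A : Finset X) (hA : Even A.card)
    {x : X} (hx : x ∈ A) (h : ∀ y ∈ A, y ≠ x → w y ∈ A) : w x ∈ A := by
  classical
  by_contra hwx
  have h1 : Even (A.erase x).card := by
    refine even_card_of_fpfInvolution hw _ fun y hy => ?_
    rw [Finset.mem_erase] at hy ⊢
    refine ⟨fun h' => hwx ?_, h y hy.2 hy.1⟩
    rw [← h', hw.inv y]; exact hy.2
  rw [Finset.card_erase_of_mem hx] at h1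
  have : 0 < A.card := Finset.card_pos.2 ⟨x, hx⟩
  rcases h1 with ⟨k, hk⟩
  rcases hA with ⟨l, hl⟩
  omega

/-- In a cycle of alternating edges, the ends of an edge remain connected without this edge. -/
theorem mem_of_closed_of_ne [Finite X] {s w : X → X} (hs : FPFInvolution s) (hw : FPFInvolution w)
    (A : Set X) {x : X} (hx : x ∈ A) (hsA : ∀ y ∈ A, s y ∈ A)
    (h : ∀ y ∈ A, y ≠ x → w y ∈ A) : w x ∈ A := by
  classical
  have := Fintype.ofFinite X
  have := mem_of_even_card hw A.toFinset
    (even_card_of_fpfInvolution hs _ (by simpa using hsA)) (x := x) (by simpa using hx)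
    (by simpa using h)
  simpa using this

end Parity

/-! ### Orbits under connected sums -/

section ConnectedSum

variable {A B : Type} {sA wA : A → A} {sB wB : B → B}

/-- The connected sum of two pairings: the edges `{a, wA a}` and `{b, wB b}` are replaced by
`{a, b}` and `{wA a, wB b}`. -/
structure IsConnectedSum (wA : A → A) (wB : B → B) (a : A) (b : B) (w : A ⊕ B → A ⊕ B) :
    Prop where
  left : ∀ z, z ≠ a → z ≠ wA a → w (Sum.inl z) = Sum.inl (wA z)
  right : ∀ z, z ≠ b → z ≠ wB b → w (Sum.inr z) = Sum.inr (wB z)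
  left_base : w (Sum.inl a) = Sum.inr b
  right_base : w (Sum.inr b) = Sum.inl a
  left_base' : w (Sum.inl (wA a)) = Sum.inr (wB b)
  right_base' : w (Sum.inr (wB b)) = Sum.inl (wA a)

theorem orb_eq_of_connectedSum_left [Finite A] (hsA : FPFInvolution sA) (hwA : FPFInvolution wA)
    {a : A} {b : B} {w : A ⊕ B → A ⊕ B} (h : IsConnectedSum wA wB a b w) :
    orb w (Sum.map sA sB) (Sum.inl (wA a)) = orb w (Sum.map sA sB) (Sum.inl a) := by
  refine mem_of_closed_of_ne hsA hwA {z | orb w (Sum.map sA sB) (Sum.inl z) =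
    orb w (Sum.map sA sB) (Sum.inl a)} rfl (fun z hz => ?_) fun z hz hza => ?_
  · have := orb_right (a := w) (b := Sum.map sA sB) (Sum.inl z)
    exact this.trans hz
  · by_cases hz' : z = wA a
    · subst hz'
      change orb _ _ (Sum.inl (wA (wA a))) = _
      rw [hwA.inv a]
    · have := orb_left (a := w) (b := Sum.map sA sB) (Sum.inl z)
      rw [h.left z hza hz'] at this
      exact this.trans hz

theorem orb_eq_of_connectedSum_right [Finite B] (hsB : FPFInvolution sB) (hwB : FPFInvolution wB)
    {a : A} {b : B} {w : A ⊕ B → A ⊕ B} (h : IsConnectedSum wA wB a b w) :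
    orb w (Sum.map sA sB) (Sum.inr (wB b)) = orb w (Sum.map sA sB) (Sum.inr b) := by
  refine mem_of_closed_of_ne hsB hwB {z | orb w (Sum.map sA sB) (Sum.inr z) =
    orb w (Sum.map sA sB) (Sum.inr b)} rfl (fun z hz => ?_) fun z hz hza => ?_
  · have := orb_right (a := w) (b := Sum.map sA sB) (Sum.inr z)
    exact this.trans hz
  · by_cases hz' : z = wB b
    · subst hz'
      change orb _ _ (Sum.inr (wB (wB b))) = _
      rw [hwB.inv b]
    · have := orb_left (a := w) (b := Sum.map sA sB) (Sum.inr z)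
      rw [h.right z hza hz'] at this
      exact this.trans hz

/-- Orbits are additive under connected sums, up to the identification of one pair of orbits. -/
theorem card_orb_connectedSum [Finite A] [Finite B] (hsA : FPFInvolution sA)
    (hwA : FPFInvolution wA) (hsB : FPFInvolution sB) (hwB : FPFInvolution wB)
    {a : A} {b : B} {w : A ⊕ B → A ⊕ B} (h : IsConnectedSum wA wB a b w) :
    Nat.card (Orb w (Sum.map sA sB)) + 1 = Nat.card (Orb wA sA) + Nat.card (Orb wB sB) := by
  classical
  set s := Sum.map sA sB with hs
  have hl := orb_eq_of_connectedSum_left (sB := sB) hsA hwA h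
  have hr := orb_eq_of_connectedSum_right (sA := sA) hsB hwB h
  have hb : orb w s (Sum.inr b) = orb w s (Sum.inl a) := by
    rw [← h.left_base]; exact orb_left _
  let g : Orb wA sA ⊕ Orb wB sB → Orb w s := Sum.elim
    (Quot.lift (fun z => orb w s (Sum.inl z)) (by
      rintro z _ (rfl | rfl)
      · by_cases h1 : z = a
        · subst h1; exact hl.symm
        · by_cases h2 : z = wA a
          · subst h2; rw [hwA.inv]; exact hl
          · rw [← h.left z h1 h2]; exact (orb_left _).symm
      · exact (orb_right (a := w) (b := s) (Sum.inl z)).symm))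
    (Quot.lift (fun z => orb w s (Sum.inr z)) (by
      rintro z _ (rfl | rfl)
      · by_cases h1 : z = b
        · subst h1; exact hr.symm
        · by_cases h2 : z = wB b
          · subst h2; rw [hwB.inv]; exact hr
          · rw [← h.right z h1 h2]; exact (orb_left _).symm
      · exact (orb_right (a := w) (b := s) (Sum.inr z)).symm))
  -- Only the orbits of `a` and `b` merge; `r` replaces the second by the first, so the orbits of
  -- the sum correspond to everything except `t₀`.
  let t₀ : Orb wA sA ⊕ Orb wB sB := Sum.inr (orb wB sB b)
  let r : Orb wA sA ⊕ Orb wB sB → Orb wA sA ⊕ Orb wB sB :=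
    fun t => if t = t₀ then Sum.inl (orb wA sA a) else t
  have hr1 : ∀ t, t ≠ t₀ → r t = t := fun t ht => if_neg ht
  have hr0 : r t₀ = Sum.inl (orb wA sA a) := if_pos rfl
  have hrne : ∀ t, r t ≠ t₀ := by
    intro t
    by_cases ht : t = t₀
    · rw [ht, hr0]; exact Sum.inl_ne_inr
    · rw [hr1 t ht]; exact ht
  have hgr : ∀ t, g (r t) = g t := by
    intro t
    by_cases ht : t = t₀
    · rw [ht, hr0]; exact hb.symm
    · rw [hr1 t ht]
  let k : A ⊕ B → Orb wA sA ⊕ Orb wB sB := Sum.map (orb wA sA) (orb wB sB)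
  have hk : ∀ z, g (k z) = orb w s z := by rintro (z | z) <;> rfl
  let f : Orb w s → {t // t ≠ t₀} := Quot.lift (fun z => ⟨r (k z), hrne _⟩) (by
    have base : r (k (Sum.inl a)) = r (k (Sum.inr b)) := by
      change r (Sum.inl (orb wA sA a)) = r t₀
      rw [hr0, hr1 _ Sum.inl_ne_inr]
    have eA : k (Sum.inl (wA a)) = k (Sum.inl a) := congrArg Sum.inl (orb_left a)
    have eB : k (Sum.inr (wB b)) = k (Sum.inr b) := congrArg Sum.inr (orb_left b)
    rintro z _ (rfl | rfl)
    · refine Subtype.ext ?_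
      rcases z with z | z
      · by_cases h1 : z = a
        · subst h1; rw [h.left_base]; exact base
        · by_cases h2 : z = wA a
          · subst h2; rw [h.left_base']
            change r (k (Sum.inl (wA a))) = r (k (Sum.inr (wB b)))
            rw [eA, eB]; exact base
          · rw [h.left z h1 h2]
            exact congrArg (fun u => r (Sum.inl u)) (orb_left z).symm
      · by_cases h1 : z = b
        · subst h1; rw [h.right_base]; exact base.symm
        · by_cases h2 : z = wB b
          · subst h2; rw [h.right_base']
            change r (k (Sum.inr (wB b))) = r (k (Sum.inl (wA a)))
            rw [eA, eB]; exact base.symm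
          · rw [h.right z h1 h2]
            exact congrArg (fun u => r (Sum.inr u)) (orb_left z).symm
    · refine Subtype.ext ?_
      rcases z with z | z
      · exact congrArg (fun u => r (Sum.inl u)) (orb_right z).symm
      · exact congrArg (fun u => r (Sum.inr u)) (orb_right z).symm)
  have hf : Function.Bijective f := by
    constructor
    · refine Function.LeftInverse.injective (g := fun t => g t.1) fun q => ?_
      induction q using Quot.ind with | mk z => exact (hgr _).trans (hk z)
    · rintro ⟨t, ht⟩
      have : ∃ z, k z = t := by
        rcases t with t | t
        · induction t using Quot.ind with | mk z => exact ⟨Sum.inl z, rfl⟩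
        · induction t using Quot.ind with | mk z => exact ⟨Sum.inr z, rfl⟩
      obtain ⟨z, rfl⟩ := this
      exact ⟨orb w s z, Subtype.ext (hr1 _ ht)⟩
  have := Fintype.ofFinite (Orb wA sA)
  have := Fintype.ofFinite (Orb wB sB)
  rw [Nat.card_congr (Equiv.ofBijective f hf), ← Nat.card_sum, Nat.card_eq_fintype_card,
    Nat.card_eq_fintype_card, Fintype.card_subtype_compl, Fintype.card_subtype_eq]
  have : 0 < Fintype.card (Orb wA sA ⊕ Orb wB sB) := Fintype.card_pos_iff.2 ⟨t₀⟩
  omega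

theorem card_orb_congr {X Y : Type} {a b : X → X} {a' b' : Y → Y} (e : X ≃ Y)
    (ha : ∀ x, e (a x) = a' (e x)) (hb : ∀ x, e (b x) = b' (e x)) :
    Nat.card (Orb a b) = Nat.card (Orb a' b') := by
  refine Nat.card_congr (Quot.congr e fun x y => ?_)
  rw [← ha, ← hb, e.apply_eq_iff_eq, e.apply_eq_iff_eq]

end ConnectedSum

/-! ### The two-coloured spheres of the octahedron: loop bound and parity -/

/-- The contraction of the colour-`c` indices inside the vertices. -/
def contract {V : Type} (c : Fin 4) (x : V × Fin 6) : V × Fin 6 := (x.1, partner c x.2)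

theorem contract_fpf {V : Type} (c : Fin 4) : FPFInvolution (contract (V := V) c) :=
  ⟨fun x => Prod.ext rfl (partner_partner c x.2),
    fun x h => partner_ne c x.2 (congrArg Prod.snd h)⟩

theorem mem_hexagon : ∀ c c' : Fin 4, c ≠ c' → ∀ i j : Fin 6, j = i ∨ j = partner c i ∨
    j = partner c' (partner c i) ∨ j = partner c (partner c' (partner c i)) ∨
    j = partner c' i ∨ j = partner c (partner c' i) := by decide

/-- A function invariant under two colours is constant on each vertex. -/
theorem eq_of_partner_invariant {α : Type} {c c' : Fin 4} (hc : c ≠ c') {f : Fin 6 → α}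
    (h : ∀ i, f (partner c i) = f i) (h' : ∀ i, f (partner c' i) = f i) (i j : Fin 6) :
    f i = f j := by
  rcases mem_hexagon c c' hc i j with rfl | rfl | rfl | rfl | rfl | rfl <;> simp only [h, h']

theorem card_orb_contract {V : Type} {c c' : Fin 4} (hc : c ≠ c') :
    Nat.card (Orb (contract (V := V) c) (contract c')) = Nat.card V := by
  refine Nat.card_congr
    { toFun := Quot.lift Prod.fst (by rintro x y (rfl | rfl) <;> rfl)
      invFun := fun v => orb _ _ (v, 0)
      left_inv := fun q => ?_
      right_inv := fun v => rfl }
  induction q using Quot.ind with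
  | mk x =>
    exact eq_of_partner_invariant hc
      (f := fun i => orb (contract (V := V) c) (contract c') (x.1, i))
      (fun i => orb_left (a := contract c) (x.1, i))
      (fun i => orb_right (b := contract c') (x.1, i)) 0 x.2

namespace WickContraction

variable {V : Type} (w : WickContraction V)

theorem fpf : FPFInvolution w.toFun := ⟨w.involutive, w.ne_self⟩

/-- A contraction is connected if no proper non-empty set of vertices is closed under it. -/
theorem connected_iff : w.graph.Connected ↔ Nonempty V ∧
    ∀ A : Set V, A.Nonempty → (∀ x, x.1 ∈ A → (w x).1 ∈ A) → ∀ v, v ∈ A := by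
  rw [SimpleGraph.connected_iff, and_comm]
  refine and_congr_right fun _ => ⟨fun h A ⟨u, hu⟩ hA v => ?_, fun h u v => ?_⟩
  · obtain ⟨p⟩ := h u v
    induction p with
    | nil => exact hu
    | @cons s t _ hadj p ih =>
      refine ih ?_
      rw [graph, SimpleGraph.fromRel_adj] at hadj
      obtain ⟨_, ⟨i, j, hij⟩ | ⟨i, j, hij⟩⟩ := hadj
      · have := hA _ (show ((s, i) : V × Fin 6).1 ∈ A from hu)
        rw [hij] at this; exact this
      · have h1 : w (s, j) = (t, i) := by rw [← hij]; exact w.involutive _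
        have := hA _ (show ((s, j) : V × Fin 6).1 ∈ A from hu)
        rw [h1] at this; exact this
  · refine h {v | w.graph.Reachable u v} ⟨u, SimpleGraph.Reachable.refl u⟩ (fun x hx => ?_) v
    by_cases hne : x.1 = (w x).1
    · rw [← hne]; exact hx
    · refine SimpleGraph.Reachable.trans hx (SimpleGraph.Adj.reachable ?_)
      rw [graph, SimpleGraph.fromRel_adj]
      exact ⟨hne, Or.inl ⟨x.2, (w x).2, rfl⟩⟩

variable {w}

theorem genConnected (hw : w.graph.Connected) {c c' : Fin 4} (hc : c ≠ c') :
    GenConnected w.toFun (contract c) (contract c') := by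
  rintro A ⟨x, hx⟩ hA y
  have hv : ∀ v i j, (v, i) ∈ A → (v, j) ∈ A := fun v i j h => by
    have := eq_of_partner_invariant hc (f := fun i => (v, i) ∈ A)
      (fun i => propext ⟨fun h => ?_, fun h => (hA _ h).2.1⟩)
      (fun i => propext ⟨fun h => ?_, fun h => (hA _ h).2.2⟩) i j
    · exact this ▸ h
    · have := (hA _ h).2.1
      rwa [contract, partner_partner] at this
    · have := (hA _ h).2.2
      rwa [contract, partner_partner] at this
  have := (w.connected_iff.1 hw).2 {v | (v, 0) ∈ A} ⟨x.1, hv _ _ _ hx⟩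
    (fun z hz => hv _ _ _ (hA _ (hv _ _ z.2 hz)).1) y.1
  exact hv _ _ _ this

/-- The bound on the number of index loops is saturated. -/
def Saturated (w : WickContraction V) : Prop :=
  ∑ c : Fin 4, w.loopsOfColour c = 4 * Nat.card V + 4

variable [Finite V]

/-- Euler's inequality for the surface of the colours `c`, `c'`, in which each vertex is one
hexagonal face. -/
theorem loopsOfColour_add_le (hw : w.graph.Connected) {c c' : Fin 4} (hc : c ≠ c') :
    w.loopsOfColour c + w.loopsOfColour c' ≤ 2 * Nat.card V + 2 := by
  have := hw.nonempty
  have h := two_mul_card_orb_le w.fpf (contract_fpf c) (contract_fpf c') (genConnected hw hc)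
  rw [card_orb_contract hc, Nat.card_prod, Nat.card_fin] at h
  change 2 * (w.loopsOfColour c + w.loopsOfColour c' + _) ≤ _ at h
  omega

theorem sum_loopsOfColour_le (hw : w.graph.Connected) :
    ∑ c : Fin 4, w.loopsOfColour c ≤ 4 * Nat.card V + 4 := by
  rw [Fin.sum_univ_four]
  have h1 := loopsOfColour_add_le hw (show (0 : Fin 4) ≠ 1 by decide)
  have h2 := loopsOfColour_add_le hw (show (2 : Fin 4) ≠ 3 by decide)
  omega

/-- Each pair of colours belongs to one of the three splittings into two pairs, so saturation forces
equality in all six pair bounds; these determine every single count. -/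
theorem Saturated.loopsOfColour_eq (hs : w.Saturated) (hw : w.graph.Connected) (c : Fin 4) :
    w.loopsOfColour c = Nat.card V + 1 := by
  have h01 := loopsOfColour_add_le hw (show (0 : Fin 4) ≠ 1 by decide)
  have h02 := loopsOfColour_add_le hw (show (0 : Fin 4) ≠ 2 by decide)
  have h03 := loopsOfColour_add_le hw (show (0 : Fin 4) ≠ 3 by decide)
  have h12 := loopsOfColour_add_le hw (show (1 : Fin 4) ≠ 2 by decide)
  have h13 := loopsOfColour_add_le hw (show (1 : Fin 4) ≠ 3 by decide)
  have h23 := loopsOfColour_add_le hw (show (2 : Fin 4) ≠ 3 by decide)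
  rw [Saturated, Fin.sum_univ_four] at hs
  fin_cases c <;> simp only [Fin.zero_eta, Fin.mk_one, Fin.reduceFinMk] <;> omega

theorem Saturated.euler (hs : w.Saturated) (hw : w.graph.Connected) {c c' : Fin 4} (hc : c ≠ c') :
    2 * (Nat.card (Orb w.toFun (contract c)) + Nat.card (Orb w.toFun (contract c')) +
      Nat.card (Orb (contract (V := V) c) (contract c'))) = Nat.card (V × Fin 6) + 4 := by
  have h1 : Nat.card (Orb w.toFun (contract c)) = _ := hs.loopsOfColour_eq hw c
  have h2 : Nat.card (Orb w.toFun (contract c')) = _ := hs.loopsOfColour_eq hw c'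
  rw [card_orb_contract hc, Nat.card_prod, Nat.card_fin]
  omega

theorem Saturated.exists_parity (hs : w.Saturated) (hw : w.graph.Connected) {c c' : Fin 4}
    (hc : c ≠ c') : ∃ ε : V → Fin 6 → ZMod 2, (∀ x, ε (w x).1 (w x).2 = ε x.1 x.2 + 1) ∧
      ∀ v i, ε v (partner c i) = ε v i + 1 ∧ ε v (partner c' i) = ε v i + 1 := by
  have := hw.nonempty
  obtain ⟨ε, hε⟩ := exists_bipartition w.fpf (contract_fpf c) (contract_fpf c')
    (genConnected hw hc) (hs.euler hw hc)
  exact ⟨fun v i => ε (v, i), fun x => (hε x).1, fun v i => ⟨(hε (v, i)).2.1, (hε (v, i)).2.2⟩⟩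

theorem zmod_two_add_one_ne (t : ZMod 2) : t + 1 ≠ t := by revert t; decide

/-- Supplies the colours for which `i` and `j` have the same parity, whereas a propagator between
them would have to change it. -/
theorem exists_even_hexagon : ∀ i j : Fin 6, i ≠ j → ∃ c c' : Fin 4, c ≠ c' ∧
    j = partner c (partner c' i) := by decide

theorem zmod_two_add_one_add_one (t : ZMod 2) : t + 1 + 1 = t := by revert t; decide

/-- Saturated contractions have no 1-cycles. -/
theorem Saturated.ne_oneCycle (hs : w.Saturated) (hw : w.graph.Connected) (v : V) (i j : Fin 6) :
    w (v, i) ≠ (v, j) := by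
  intro h
  have hij : i ≠ j := fun h' => w.ne_self (v, i) (by rw [h, h'])
  obtain ⟨c, c', hc, rfl⟩ := exists_even_hexagon i j hij
  obtain ⟨ε, h1, h2⟩ := hs.exists_parity hw hc
  have := h1 (v, i)
  rw [h, (h2 _ _).1, (h2 _ _).2, zmod_two_add_one_add_one] at this
  exact zmod_two_add_one_ne _ this.symm

/-- In the hexagon of `c`, `c'`, passing to the `a`-partner preserves parity at one of `i`, `j` and
reverses it at the other. Two propagators joining these pairs would both reverse parity, a
contradiction. -/
theorem exists_parity_hexagon : ∀ (a : Fin 4) (i j : Fin 6), j ≠ i → j ≠ partner a i →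
    ∃ c c' : Fin 4, c ≠ c' ∧
      ((partner a i = partner c (partner c' i) ∧
        partner a j = partner c (partner c' (partner c j))) ∨
      (partner a i = partner c (partner c' (partner c i)) ∧
        partner a j = partner c (partner c' j))) := by decide

/-- A loop of length two joins equal pairs of labels. -/
theorem Saturated.eq_or_eq_of_twoCycle (hs : w.Saturated) (hw : w.graph.Connected) {u v : V}
    {a : Fin 4} {i j : Fin 6} (h : w (u, i) = (v, j))
    (h' : w (u, partner a i) = (v, partner a j)) : j = i ∨ j = partner a i := by
  by_contra! hne
  obtain ⟨c, c', hc, hcase⟩ := exists_parity_hexagon a i j hne.1 hne.2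
  obtain ⟨ε, h1, h2⟩ := hs.exists_parity hw hc
  have e1 := h1 (u, i)
  have e2 := h1 (u, partner a i)
  rw [h] at e1
  rw [h'] at e2
  rcases hcase with ⟨g1, g2⟩ | ⟨g1, g2⟩ <;> rw [g1, g2] at e2 <;>
    simp only [fun v i => (h2 v i).1, fun v i => (h2 v i).2, zmod_two_add_one_add_one] at e1 e2
  · rw [e1] at e2
    exact zmod_two_add_one_ne _ e2
  · rw [e1] at e2
    exact zmod_two_add_one_ne _ e2

end WickContraction

/-- Orbits are cycles of even length; `h1` excludes length two and `h2` length four. -/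
theorem six_mul_card_orb_le {X : Type} [Finite X] {a b : X → X} (ha : FPFInvolution a)
    (hb : FPFInvolution b) (h1 : ∀ x, a x ≠ b x) (h2 : ∀ x, a (b x) ≠ b (a x)) :
    6 * Nat.card (Orb a b) ≤ Nat.card X := by
  classical
  have := Fintype.ofFinite X
  have := Fintype.ofFinite (Orb a b)
  rw [Nat.card_eq_fintype_card, Nat.card_eq_fintype_card, ← Finset.card_univ (α := X),
    Finset.card_eq_sum_card_fiberwise (f := orb a b) (t := Finset.univ) (fun _ _ => by simp),
    mul_comm, ← smul_eq_mul, ← Finset.card_univ]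
  refine Finset.card_nsmul_le_sum _ _ _ fun q _ => ?_
  induction q using Quot.ind with
  | mk x =>
    have hsub : ({x, a x, b x, a (b x), b (a x), b (a (b x))} : Finset X) ⊆
        Finset.univ.filter (fun y => orb a b y = orb a b x) := by
      intro y hy
      simp only [Finset.mem_insert, Finset.mem_singleton] at hy
      rw [Finset.mem_filter]
      refine ⟨Finset.mem_univ _, ?_⟩
      rcases hy with rfl | rfl | rfl | rfl | rfl | rfl <;> simp only [orb_left, orb_right]
    refine le_trans ?_ (Finset.card_le_card hsub)
    have ia := ha.inv
    have ib := hb.inv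
    have flip_a : ∀ {y z : X}, a y = z → y = a z := fun h => by rw [← h, ia]
    have flip_b : ∀ {y z : X}, b y = z → y = b z := fun h => by rw [← h, ib]
    have n1 : x ≠ a x := (ha.ne x).symm
    have n2 : x ≠ b x := (hb.ne x).symm
    have n3 : x ≠ a (b x) := fun h => h1 x (flip_a h.symm).symm
    have n4 : x ≠ b (a x) := fun h => h1 x (flip_b h.symm)
    have n5 : x ≠ b (a (b x)) := fun h => ha.ne (b x) (flip_b h.symm)
    have n6 : a x ≠ b x := h1 x
    have n7 : a x ≠ a (b x) := fun h => n2 (ia.injective h)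
    have n8 : a x ≠ b (a x) := (hb.ne _).symm
    have n9 : a x ≠ b (a (b x)) := fun h => h2 x (flip_b h.symm)
    have n10 : b x ≠ a (b x) := (ha.ne _).symm
    have n11 : b x ≠ b (a x) := fun h => n1 (ib.injective h)
    have n12 : b x ≠ b (a (b x)) := fun h => n3 (ib.injective h)
    have n13 : a (b x) ≠ b (a x) := h2 x
    have n14 : a (b x) ≠ b (a (b x)) := (hb.ne _).symm
    have n15 : b (a x) ≠ b (a (b x)) := fun h => n7 (ib.injective h)
    simp [n1, n2, n3, n4, n5, n6, n7, n8, n9, n10, n11, n12, n13, n14, n15]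

/-! ### Arcs in the hexagons of one vertex -/

/-- The colours `a`, `b` bound a hexagon in which two or three edges, the first of colour `a`,
lead from `i` to `k`. -/
def IsArc (a b : Fin 4) (i k : Fin 6) : Prop :=
  a ≠ b ∧ (k = partner b (partner a i) ∨ k = partner a (partner b (partner a i)))

instance (a b : Fin 4) (i k : Fin 6) : Decidable (IsArc a b i k) :=
  inferInstanceAs (Decidable (_ ∧ _))

/-- The indicator of the edges of the first colour on an arc. -/
def arcFst (a b : Fin 4) (i k m : Fin 6) : ZMod 2 :=
  if m = i ∨ m = partner a i ∨
    (k ≠ partner b (partner a i) ∧ (m = k ∨ m = partner a k)) then 1 else 0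

/-- The indicator of the edges of the second colour on an arc. -/
def arcSnd (a b : Fin 4) (i m : Fin 6) : ZMod 2 :=
  if m = partner a i ∨ m = partner b (partner a i) then 1 else 0

set_option maxRecDepth 100000 in
theorem arcFst_partner : ∀ a b i k, IsArc a b i k → ∀ m,
    arcFst a b i k (partner a m) = arcFst a b i k m := by decide

set_option maxRecDepth 100000 in
theorem arcSnd_partner : ∀ a b i m, arcSnd a b i (partner b m) = arcSnd a b i m := by decide

-- The arc has odd degree exactly at its ends, so arcs at two vertices close up with two propagators
-- to a cycle modulo 2.
set_option maxRecDepth 100000 in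
theorem arc_boundary : ∀ a b i k, IsArc a b i k → ∀ m,
    (if m = i ∨ m = k then 1 else 0) + arcFst a b i k m + arcSnd a b i m = 0 := by decide

set_option maxRecDepth 100000 in
theorem exists_arc_separating : ∀ (c : Fin 4) (i m n : Fin 6), m ≠ n → m ≠ i → m ≠ partner c i →
    n ≠ i → n ≠ partner c i → ∃ a b, IsArc a b i (partner c i) ∧
      arcFst a b i (partner c i) m ≠ arcFst a b i (partner c i) n := by decide

-- A crossed propagator from `i` to `partner c i` fixes the offset between the potentials at the two
-- vertices. The two added terms account for this offset.
set_option maxRecDepth 100000 in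
theorem exists_arc_separating_crossed : ∀ (c : Fin 4) (i m n : Fin 6), m ≠ i → m ≠ partner c i →
    n ≠ i → n ≠ partner c i → ∃ a b, IsArc a b i (partner c i) ∧
      arcFst a b i (partner c i) m + arcFst a b i (partner c i) i ≠
      arcFst a b i (partner c i) n + arcFst a b i (partner c i) (partner c i) := by decide

theorem exists_ne_ne : ∀ i k : Fin 6, ∃ r, r ≠ i ∧ r ≠ k := by decide

/-! ### Separation by loops of two propagators -/

namespace WickContraction

variable {V : Type} {w : WickContraction V}

/-- Two propagators join the fields `i`, `k` of the vertices `u` and `v`. -/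
structure JoinsPairs (w : WickContraction V) (u v : V) (i k : Fin 6) : Prop where
  ne : u ≠ v
  left : ∀ m, m = i ∨ m = k → (w (u, m)).1 = v ∧ ((w (u, m)).2 = i ∨ (w (u, m)).2 = k)
  right : ∀ m, m = i ∨ m = k → (w (v, m)).1 = u ∧ ((w (v, m)).2 = i ∨ (w (v, m)).2 = k)

theorem JoinsPairs.symm {u v : V} {i k : Fin 6} (h : w.JoinsPairs u v i k) :
    w.JoinsPairs v u i k := ⟨h.ne.symm, h.right, h.left⟩

theorem JoinsPairs.ne_of_eq {u v : V} {i k : Fin 6} (hj : w.JoinsPairs u v i k) {x : V × Fin 6}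
    (hx : x.1 ≠ v) {n : Fin 6} (h : w x = (u, n)) : n ≠ i ∧ n ≠ k := by
  have key : n = i ∨ n = k → False := fun hn => by
    have := (hj.left n hn).1
    rw [← h, w.involutive x] at this
    exact hx this
  tauto

variable [Finite V]

/-- The closed curve through `u` and `v` along two propagators separates a planar diagram. -/
theorem Saturated.exists_separation (hs : w.Saturated) (hw : w.graph.Connected) {u v : V}
    {i k : Fin 6} (hj : w.JoinsPairs u v i k) {a b : Fin 4} (hab : IsArc a b i k) :
    ∃ ψ : V → Fin 6 → ZMod 2, (∀ x, ψ (w x).1 (w x).2 = ψ x.1 x.2) ∧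
      (∀ t, t ≠ u → t ≠ v → ∀ m n, ψ t m = ψ t n) ∧
      ∃ p q, ∀ m, ψ u m = p + arcFst a b i k m ∧ ψ v m = q + arcFst a b i k m := by
  classical
  have := hw.nonempty
  -- The closed curve: `γ` marks its two propagators, `α` and `β` its edges of colours `a` and `b`
  -- inside `u` and `v`.
  let γ : V × Fin 6 → ZMod 2 := fun x =>
    if (x.1 = u ∨ x.1 = v) ∧ (x.2 = i ∨ x.2 = k) then 1 else 0
  let α : V × Fin 6 → ZMod 2 := fun x => if x.1 = u ∨ x.1 = v then arcFst a b i k x.2 else 0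
  let β : V × Fin 6 → ZMod 2 := fun x => if x.1 = u ∨ x.1 = v then arcSnd a b i x.2 else 0
  have hcl : ∀ x : V × Fin 6, (x.1 = u ∨ x.1 = v) ∧ (x.2 = i ∨ x.2 = k) →
      ((w x).1 = u ∨ (w x).1 = v) ∧ ((w x).2 = i ∨ (w x).2 = k) := by
    rintro ⟨t, m⟩ ⟨rfl | rfl, hm⟩
    · exact ⟨Or.inr (hj.left m hm).1, (hj.left m hm).2⟩
    · exact ⟨Or.inl (hj.right m hm).1, (hj.right m hm).2⟩
  have hγ : ∀ x, γ (w x) = γ x := fun x => by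
    have : ((w x).1 = u ∨ (w x).1 = v) ∧ ((w x).2 = i ∨ (w x).2 = k) ↔
        (x.1 = u ∨ x.1 = v) ∧ (x.2 = i ∨ x.2 = k) :=
      ⟨fun h => by have := hcl _ h; rwa [w.involutive x] at this, hcl x⟩
    simp only [γ, this]
  have hα : ∀ x, α (contract a x) = α x := fun x => by
    simp only [α, contract, arcFst_partner a b i k hab]
  have hβ : ∀ x, β (contract b x) = β x := fun x => by
    simp only [β, contract, arcSnd_partner a b i]
  have h0 : ∀ x, γ x + α x + β x = 0 := fun x => by
    by_cases hx : x.1 = u ∨ x.1 = v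
    · simpa only [γ, α, β, hx, true_and, if_true] using arc_boundary a b i k hab x.2
    · simp [γ, α, β, hx]
  obtain ⟨p, q, r, hp, -, hr, hpqr⟩ := exists_face_potential w.fpf (contract_fpf a)
    (contract_fpf b) (genConnected hw hab.1) (hs.euler hw hab.1) γ α β hγ hα hβ h0
  have hr' : ∀ t m n, r (t, m) = r (t, n) := fun t m n =>
    eq_of_partner_invariant hab.1 (f := fun m => r (t, m)) (fun m => (hr (t, m)).1)
      (fun m => (hr (t, m)).2) m n
  -- `r` is the side of the curve on which a hexagon lies and `p` that of a colour-`a` index loop;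
  -- they differ only across the curve.
  have hpr : ∀ t m, p (t, m) = r (t, 0) + α (t, m) := fun t m => by
    have h1 := (hpqr (t, m)).2.1
    have : ∀ x y z : ZMod 2, x + y = z → x = y + z := by decide
    rw [hr' t 0 m]
    exact this _ _ _ h1
  refine ⟨fun t m => p (t, m), fun x => (hp x).1, fun t hu hv m n => ?_, r (u, 0), r (v, 0),
    fun m => ⟨?_, ?_⟩⟩
  · simp only [hpr, α, hu, hv, or_self, if_false]
  · simp only [hpr, α, true_or, if_true]
  · simp only [hpr, α, or_true, if_true]

/-- All separations by closed curves through two propagators, combined. -/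
theorem Saturated.exists_separations (hs : w.Saturated) (hw : w.graph.Connected) {u v : V}
    {c : Fin 4} {i : Fin 6} (hj : w.JoinsPairs u v i (partner c i)) :
    ∃ Ψ : V → Fin 6 → (Fin 4 → Fin 4 → ZMod 2), (∀ x, Ψ (w x).1 (w x).2 = Ψ x.1 x.2) ∧
      (∀ t, t ≠ u → t ≠ v → ∀ m n, Ψ t m = Ψ t n) ∧
      (∀ m n, m ≠ i → m ≠ partner c i → n ≠ i → n ≠ partner c i → Ψ u m = Ψ u n → m = n) ∧
      ((w (u, i)).2 = i → ∀ m, Ψ v m = Ψ u m) ∧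
      ((w (u, i)).2 = partner c i → ∀ m n, m ≠ i → m ≠ partner c i → n ≠ i → n ≠ partner c i →
        Ψ u m ≠ Ψ v n) := by
  have hex : ∀ a b, ∃ ψ : V → Fin 6 → ZMod 2, IsArc a b i (partner c i) →
      (∀ x, ψ (w x).1 (w x).2 = ψ x.1 x.2) ∧ (∀ t, t ≠ u → t ≠ v → ∀ m n, ψ t m = ψ t n) ∧
      ∃ p q, ∀ m, ψ u m = p + arcFst a b i (partner c i) m ∧
        ψ v m = q + arcFst a b i (partner c i) m := fun a b => by
    by_cases hab : IsArc a b i (partner c i)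
    · obtain ⟨ψ, hψ⟩ := hs.exists_separation hw hj hab
      exact ⟨ψ, fun _ => hψ⟩
    · exact ⟨0, fun h => absurd h hab⟩
  choose ψ hψ using hex
  have hi := (hj.left i (Or.inl rfl)).1
  refine ⟨fun t m a b => if IsArc a b i (partner c i) then ψ a b t m else 0, fun x => ?_,
    fun t hu hv m n => ?_, fun m n hm hm' hn hn' h => ?_, fun h m => ?_,
    fun h m n hm hm' hn hn' heq => ?_⟩
  · funext a b
    beta_reduce
    split_ifs with hab
    · exact (hψ a b hab).1 x
    · rfl
  · funext a b
    beta_reduce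
    split_ifs with hab
    · exact (hψ a b hab).2.1 t hu hv m n
    · rfl
  · by_contra hmn
    obtain ⟨a, b, hab, hne⟩ := exists_arc_separating c i m n hmn hm hm' hn hn'
    obtain ⟨-, -, p, q, hpq⟩ := hψ a b hab
    have := congrFun (congrFun h a) b
    simp only [if_pos hab] at this
    rw [(hpq m).1, (hpq n).1] at this
    exact hne (add_left_cancel this)
  · funext a b
    beta_reduce
    split_ifs with hab
    · obtain ⟨h1, -, p, q, hpq⟩ := hψ a b hab
      have e := h1 (u, i)
      rw [hi, h, (hpq i).1, (hpq i).2] at e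
      rw [(hpq m).1, (hpq m).2, add_right_cancel e]
    · rfl
  · obtain ⟨a, b, hab, hne⟩ := exists_arc_separating_crossed c i m n hm hm' hn hn'
    obtain ⟨h1, -, p, q, hpq⟩ := hψ a b hab
    have e := h1 (u, i)
    rw [hi, h, (hpq i).1, (hpq (partner c i)).2] at e
    have := congrFun (congrFun heq a) b
    simp only [if_pos hab] at this
    rw [(hpq m).1, (hpq n).2] at this
    refine hne ?_
    have two : (2 : ZMod 2) = 0 := rfl
    linear_combination this + e + (arcFst a b i (partner c i) i -
      arcFst a b i (partner c i) (partner c i)) * two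

/-- In a loop of length two, the two propagators are not crossed. -/
theorem Saturated.not_crossed (hs : w.Saturated) (hw : w.graph.Connected) {u v : V}
    {c : Fin 4} {i : Fin 6} (hj : w.JoinsPairs u v i (partner c i)) :
    (w (u, i)).2 ≠ partner c i := by
  classical
  intro hcross
  obtain ⟨Ψ, h1, h2, h3, -, h5⟩ := hs.exists_separations hw hj
  replace h5 := h5 hcross
  obtain ⟨r, hr, hr'⟩ := exists_ne_ne i (partner c i)
  have := Fintype.ofFinite V
  -- The region reached from field `r` of `u`. The separations exclude propagators from it to `v` or
  -- to other fields of `u`, so it has a single outgoing propagator, although its number of fields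
  -- is even.
  let T : Finset (V × Fin 6) := Finset.univ.filter fun x => x.1 ≠ u ∧ x.1 ≠ v ∧ Ψ x.1 x.2 = Ψ u r
  have hT : ∀ x, x ∈ T ↔ x.1 ≠ u ∧ x.1 ≠ v ∧ Ψ x.1 x.2 = Ψ u r := by simp [T]
  have hstep : ∀ x : V × Fin 6, x.1 ≠ v → (x.1 = u → x.2 = r) → Ψ x.1 x.2 = Ψ u r →
      x ≠ w (u, r) → w x ∈ T := by
    intro x hxv hxu hx hne
    rw [hT]
    refine ⟨fun h => ?_, fun h => ?_, (h1 x).trans hx⟩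
    · have hwx : w x = (u, (w x).2) := Prod.ext h rfl
      have hn := hj.ne_of_eq hxv hwx
      have e := h1 x
      rw [h, hx] at e
      have := h3 _ _ hn.1 hn.2 hr hr' e
      rw [this] at hwx
      exact hne (by rw [← hwx, w.involutive x])
    · have hwx : w x = (v, (w x).2) := Prod.ext h rfl
      have hn : (w x).2 ≠ i ∧ (w x).2 ≠ partner c i := by
        by_cases hxu' : x.1 = u
        · have key : (w x).2 = i ∨ (w x).2 = partner c i → False := fun hm => by
            have := (hj.right _ hm).2
            rw [← hwx, w.involutive x, hxu hxu'] at this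
            tauto
          tauto
        · exact hj.symm.ne_of_eq hxu' hwx
      have e := h1 x
      rw [h, hx] at e
      exact h5 _ _ hr hr' hn.1 hn.2 e.symm
  have hmem : w (u, r) ∈ T :=
    hstep (u, r) hj.ne (fun _ => rfl) rfl (fun h => w.ne_self _ h.symm)
  have heven : Even T.card := even_card_of_fpfInvolution (contract_fpf 0) T fun x hx => by
    rw [hT] at hx ⊢
    exact ⟨hx.1, hx.2.1, (h2 x.1 hx.1 hx.2.1 _ _).trans hx.2.2⟩
  have := mem_of_even_card w.fpf T heven hmem fun y hy hne => by
    rw [hT] at hy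
    exact hstep y hy.2.1 (fun h => absurd h hy.1) hy.2.2 hne
  rw [w.involutive, hT] at this
  exact this.1 rfl

/-- A saturated contraction has a loop of length two. -/
theorem Saturated.exists_joinsPairs (hs : w.Saturated) (hw : w.graph.Connected) :
    ∃ u v c i, w.JoinsPairs u v i (partner c i) ∧ w (u, i) = (v, i) ∧
      w (u, partner c i) = (v, partner c i) := by
  have hex : ∃ x, w (contract 0 x) = contract 0 (w x) := by
    -- Otherwise each of the `v + 1` loops of colour 0 passes through at least six of the `6v`
    -- fields.
    by_contra! h
    have h1 : ∀ x, w x ≠ contract 0 x := fun x hx => hs.ne_oneCycle hw x.1 x.2 (partner 0 x.2) hx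
    have := six_mul_card_orb_le w.fpf (contract_fpf 0) h1 h
    have h2 : Nat.card (Orb w.toFun (contract 0)) = _ := hs.loopsOfColour_eq hw 0
    rw [h2, Nat.card_prod, Nat.card_fin] at this
    omega
  obtain ⟨⟨u, i⟩, hx⟩ := hex
  rcases hw' : w (u, i) with ⟨v, j⟩
  rw [hw'] at hx
  change w (u, partner 0 i) = (v, partner 0 j) at hx
  have huv : u ≠ v := fun h => hs.ne_oneCycle hw u i j (by rw [hw', h])
  have hj := hs.eq_or_eq_of_twoCycle hw hw' hx
  have i1 : w (v, j) = (u, i) := by rw [← hw', w.involutive]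
  have i2 : w (v, partner 0 j) = (u, partner 0 i) := by rw [← hx, w.involutive]
  have hJ : w.JoinsPairs u v i (partner 0 i) := by
    rcases hj with rfl | rfl
    · exact ⟨huv, by rintro m (rfl | rfl) <;> simp [hw', hx],
        by rintro m (rfl | rfl) <;> simp [i1, i2]⟩
    · rw [partner_partner] at hx i2
      exact ⟨huv, by rintro m (rfl | rfl) <;> simp [hw', hx],
        by rintro m (rfl | rfl) <;> simp [i1, i2]⟩
  have hji : j = i := by
    have := hs.not_crossed hw hJ
    rw [hw'] at this
    exact hj.resolve_right this
  subst hji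
  exact ⟨u, v, 0, j, hJ, hw', hx⟩

end WickContraction
-- Connected sums and two-propagator cuts of contractions
namespace WickContraction

section Sum

variable {V V₁ V₂ : Type}

/-- The inclusion of the fields of the two summands of a set of vertices. -/
def sumFields (e : V₁ ⊕ V₂ ≃ V) : (V₁ × Fin 6) ⊕ (V₂ × Fin 6) ≃ V × Fin 6 :=
  (Equiv.sumProdDistrib V₁ V₂ (Fin 6)).symm.trans (e.prodCongr (Equiv.refl _))

theorem sumFields_inl (e : V₁ ⊕ V₂ ≃ V) (z : V₁ × Fin 6) :
    sumFields e (Sum.inl z) = (e (Sum.inl z.1), z.2) := rfl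

theorem sumFields_inr (e : V₁ ⊕ V₂ ≃ V) (z : V₂ × Fin 6) :
    sumFields e (Sum.inr z) = (e (Sum.inr z.1), z.2) := rfl

/-- `w` is the connected sum of `w₁` and `w₂` along the propagators at `x₁` and `x₂`. -/
structure IsSum (w₁ : WickContraction V₁) (w₂ : WickContraction V₂) (w : WickContraction V)
    (x₁ : V₁ × Fin 6) (x₂ : V₂ × Fin 6) (e : V₁ ⊕ V₂ ≃ V) : Prop where
  left : ∀ z, z ≠ x₁ → z ≠ w₁ x₁ →
    w (sumFields e (Sum.inl z)) = sumFields e (Sum.inl (w₁ z))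
  right : ∀ z, z ≠ x₂ → z ≠ w₂ x₂ →
    w (sumFields e (Sum.inr z)) = sumFields e (Sum.inr (w₂ z))
  base : w (sumFields e (Sum.inl x₁)) = sumFields e (Sum.inr x₂)
  base' : w (sumFields e (Sum.inl (w₁ x₁))) = sumFields e (Sum.inr (w₂ x₂))

variable {w₁ : WickContraction V₁} {w₂ : WickContraction V₂} {w : WickContraction V}
  {x₁ : V₁ × Fin 6} {x₂ : V₂ × Fin 6} {e : V₁ ⊕ V₂ ≃ V}

theorem IsSum.loopsOfColour_add_one [Finite V₁] [Finite V₂] (h : IsSum w₁ w₂ w x₁ x₂ e)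
    (c : Fin 4) : w.loopsOfColour c + 1 = w₁.loopsOfColour c + w₂.loopsOfColour c := by
  have hs : IsConnectedSum w₁.toFun w₂.toFun x₁ x₂
      (fun z => (sumFields e).symm (w (sumFields e z))) :=
    { left := fun z h1 h2 => by simp [h.left z h1 h2]
      right := fun z h1 h2 => by simp [h.right z h1 h2]
      left_base := by simp [h.base]
      right_base := by simp [← h.base, w.involutive _]
      left_base' := by simp [h.base']
      right_base' := by simp [← h.base', w.involutive _] }
  have := card_orb_connectedSum (contract_fpf c) w₁.fpf (contract_fpf c) w₂.fpf hs
  rw [card_orb_congr (a' := w.toFun) (b' := contract c) (sumFields e) (fun x => by simp)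
    (by rintro (x | x) <;> rfl)] at this
  exact this

theorem IsSum.sum_loopsOfColour [Finite V₁] [Finite V₂] (h : IsSum w₁ w₂ w x₁ x₂ e) :
    ∑ c, w.loopsOfColour c + 4 = ∑ c, w₁.loopsOfColour c + ∑ c, w₂.loopsOfColour c := by
  simp only [Fin.sum_univ_four]
  have h0 := h.loopsOfColour_add_one 0
  have h1 := h.loopsOfColour_add_one 1
  have h2 := h.loopsOfColour_add_one 2
  have h3 := h.loopsOfColour_add_one 3
  omega

theorem card_eq_of_sum [Finite V₁] [Finite V₂] (e : V₁ ⊕ V₂ ≃ V) :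
    Nat.card V = Nat.card V₁ + Nat.card V₂ := by
  rw [← Nat.card_congr e, Nat.card_sum]

theorem IsSum.saturated [Finite V₁] [Finite V₂] (h : IsSum w₁ w₂ w x₁ x₂ e)
    (h₁ : w₁.Saturated) (h₂ : w₂.Saturated) : w.Saturated := by
  have := h.sum_loopsOfColour
  have := card_eq_of_sum e
  unfold Saturated at *
  omega

/-- The defect `4v + 4 - f` is additive under connected sums and non-negative on connected diagrams.
-/
theorem IsSum.saturated_left [Finite V₁] [Finite V₂] (h : IsSum w₁ w₂ w x₁ x₂ e)
    (hw₁ : w₁.graph.Connected) (hw₂ : w₂.graph.Connected) (hs : w.Saturated) :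
    w₁.Saturated := by
  have := h.sum_loopsOfColour
  have := card_eq_of_sum e
  have := sum_loopsOfColour_le hw₁
  have := sum_loopsOfColour_le hw₂
  unfold Saturated at *
  omega

theorem IsSum.connected_left (h : IsSum w₁ w₂ w x₁ x₂ e) (hw : w.graph.Connected) :
    w₁.graph.Connected := by
  rw [connected_iff] at hw ⊢
  refine ⟨⟨x₁.1⟩, fun A hA hcl v => ?_⟩
  have hsurj : ∀ x, ∃ z, x = sumFields e z := fun x => ⟨_, ((sumFields e).apply_symm_apply x).symm⟩
  have mem_l : ∀ (C : Set (V₁ ⊕ V₂)) z, (sumFields e (Sum.inl z)).1 ∈ e '' C ↔ Sum.inl z.1 ∈ C :=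
    fun C z => by rw [sumFields_inl]; exact e.injective.mem_set_image
  have mem_r : ∀ (C : Set (V₁ ⊕ V₂)) z, (sumFields e (Sum.inr z)).1 ∈ e '' C ↔ Sum.inr z.1 ∈ C :=
    fun C z => by rw [sumFields_inr]; exact e.injective.mem_set_image
  have base_r : w (sumFields e (Sum.inr x₂)) = sumFields e (Sum.inl x₁) := by
    rw [← h.base, w.involutive]
  have base_r' : w (sumFields e (Sum.inr (w₂ x₂))) = sumFields e (Sum.inl (w₁ x₁)) := by
    rw [← h.base', w.involutive]
  have hcl' : x₁.1 ∈ A ↔ (w₁ x₁).1 ∈ A :=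
    ⟨fun h => hcl _ h, fun h => by have := hcl _ h; rwa [w₁.involutive] at this⟩
  obtain ⟨u, hu⟩ := hA
  -- A closed set of the first summand is extended by all or none of the second, according to
  -- whether it contains the ends of the propagator that was cut.
  set C : Set (V₁ ⊕ V₂) := {t | Sum.elim (fun v => v ∈ A) (fun _ => x₁.1 ∈ A) t} with hC
  have := hw.2 (e '' C) ⟨_, Sum.inl u, hu, rfl⟩ (fun x hx => ?_) (e (Sum.inl v))
  · exact (e.injective.mem_set_image).1 this
  · obtain ⟨z | z, rfl⟩ := hsurj x
    · rw [mem_l] at hx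
      by_cases h1 : z = x₁
      · subst h1; rw [h.base, mem_r]; exact hx
      · by_cases h2 : z = w₁ x₁
        · subst h2; rw [h.base', mem_r]; exact hcl'.2 hx
        · rw [h.left z h1 h2, mem_l]; exact hcl z hx
    · rw [mem_r] at hx
      by_cases h1 : z = x₂
      · subst h1; rw [base_r, mem_l]; exact hx
      · by_cases h2 : z = w₂ x₂
        · subst h2; rw [base_r', mem_l]; exact hcl'.1 hx
        · rw [h.right z h1 h2, mem_r]; exact hx

theorem IsSum.symm (h : IsSum w₁ w₂ w x₁ x₂ e) :
    IsSum w₂ w₁ w x₂ x₁ ((Equiv.sumComm V₂ V₁).trans e) where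
  left := h.right
  right := h.left
  base := (w.involutive.eq_iff.1 h.base).symm
  base' := (w.involutive.eq_iff.1 h.base').symm

end Sum

section Cut

variable {V : Type} {w : WickContraction V} {S : Set V} {x y : V × Fin 6}

/-- Exactly two propagators leave the set `S` of vertices, at the fields `x` and `y`. -/
structure IsCut (w : WickContraction V) (S : Set V) (x y : V × Fin 6) : Prop where
  ne : x ≠ y
  left_mem : x.1 ∈ S
  right_mem : y.1 ∈ S
  left_not_mem : (w x).1 ∉ S
  right_not_mem : (w y).1 ∉ S
  mem : ∀ z, z.1 ∈ S → z ≠ x → z ≠ y → (w z).1 ∈ S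

theorem IsCut.compl (h : w.IsCut S x y) : w.IsCut Sᶜ (w x) (w y) where
  ne := fun h' => h.ne (w.involutive.injective h')
  left_mem := h.left_not_mem
  right_mem := h.right_not_mem
  left_not_mem := by rw [w.involutive]; exact fun h' => h' h.left_mem
  right_not_mem := by rw [w.involutive]; exact fun h' => h' h.right_mem
  mem := fun z hz hx hy hwz => hz (by
    have := h.mem (w z) hwz (fun h' => hx (by rw [← h', w.involutive]))
      (fun h' => hy (by rw [← h', w.involutive]))
    rwa [w.involutive] at this)

/-- The inclusion of the fields of `S`. -/
def fieldOf (z : S × Fin 6) : V × Fin 6 := (z.1.1, z.2)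

theorem fieldOf_injective : Function.Injective (fieldOf (S := S)) := fun z z' h => by
  rw [fieldOf, fieldOf, Prod.mk.injEq] at h
  exact Prod.ext (Subtype.ext h.1) h.2

open Classical in
/-- The pairing of the fields of `S` in which the two fields at a cut are joined. -/
noncomputable def IsCut.closeUpFun (h : w.IsCut S x y) (z : S × Fin 6) : S × Fin 6 :=
  if hx : fieldOf z = x then (⟨y.1, h.right_mem⟩, y.2)
  else if hy : fieldOf z = y then (⟨x.1, h.left_mem⟩, x.2)
  else (⟨(w (fieldOf z)).1, h.mem _ z.1.2 hx hy⟩, (w (fieldOf z)).2)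

theorem IsCut.closeUpFun_left (h : w.IsCut S x y) {z : S × Fin 6} (hz : fieldOf z = x) :
    fieldOf (h.closeUpFun z) = y := by
  unfold closeUpFun
  rw [dif_pos hz]; rfl

theorem IsCut.closeUpFun_right (h : w.IsCut S x y) {z : S × Fin 6} (hz : fieldOf z = y) :
    fieldOf (h.closeUpFun z) = x := by
  unfold closeUpFun
  rw [dif_neg (fun h' => h.ne (h'.symm.trans hz)), dif_pos hz]; rfl

theorem IsCut.closeUpFun_other (h : w.IsCut S x y) {z : S × Fin 6} (hx : fieldOf z ≠ x)
    (hy : fieldOf z ≠ y) : fieldOf (h.closeUpFun z) = w (fieldOf z) := by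
  unfold closeUpFun
  rw [dif_neg hx, dif_neg hy]; rfl

/-- The contraction of the fields of `S` in which the two fields at a cut are joined. -/
noncomputable def IsCut.closeUp (h : w.IsCut S x y) : WickContraction S where
  toFun := h.closeUpFun
  involutive := fun z => fieldOf_injective <| by
    by_cases hx : fieldOf z = x
    · rw [h.closeUpFun_right (h.closeUpFun_left hx), hx]
    · by_cases hy : fieldOf z = y
      · rw [h.closeUpFun_left (h.closeUpFun_right hy), hy]
      · have e := h.closeUpFun_other hx hy
        rw [h.closeUpFun_other, e, w.involutive]
        · rw [e]; exact fun h' => h.left_not_mem (by rw [← h', w.involutive]; exact z.1.2)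
        · rw [e]; exact fun h' => h.right_not_mem (by rw [← h', w.involutive]; exact z.1.2)
  ne_self := fun z hz => by
    have hz' := congrArg fieldOf hz
    by_cases hx : fieldOf z = x
    · rw [h.closeUpFun_left hx, hx] at hz'; exact h.ne hz'.symm
    · by_cases hy : fieldOf z = y
      · rw [h.closeUpFun_right hy, hy] at hz'; exact h.ne hz'
      · rw [h.closeUpFun_other hx hy] at hz'; exact w.ne_self _ hz'

theorem IsCut.closeUp_left (h : w.IsCut S x y) {z : S × Fin 6} (hz : fieldOf z = x) :
    fieldOf (h.closeUp z) = y := h.closeUpFun_left hz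

theorem IsCut.closeUp_right (h : w.IsCut S x y) {z : S × Fin 6} (hz : fieldOf z = y) :
    fieldOf (h.closeUp z) = x := h.closeUpFun_right hz

theorem IsCut.closeUp_other (h : w.IsCut S x y) {z : S × Fin 6} (hx : fieldOf z ≠ x)
    (hy : fieldOf z ≠ y) : fieldOf (h.closeUp z) = w (fieldOf z) := h.closeUpFun_other hx hy

open Classical in
/-- A contraction with a cut is the connected sum of the two closed-up parts. -/
theorem IsCut.isSum (h : w.IsCut S x y) :
    IsSum h.closeUp h.compl.closeUp w (⟨x.1, h.left_mem⟩, x.2)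
      (⟨(w x).1, h.left_not_mem⟩, (w x).2) (Equiv.Set.sumCompl S) := by
  have hl : ∀ z, sumFields (Equiv.Set.sumCompl S) (Sum.inl z) = fieldOf z := fun z => rfl
  have hr : ∀ z, sumFields (Equiv.Set.sumCompl S) (Sum.inr z) = fieldOf z := fun z => rfl
  have e1 := h.closeUp_left (z := (⟨x.1, h.left_mem⟩, x.2)) rfl
  have e2 := h.compl.closeUp_left (z := (⟨(w x).1, h.left_not_mem⟩, (w x).2)) rfl
  refine ⟨fun z h1 h2 => ?_, fun z h1 h2 => ?_, ?_, ?_⟩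
  · rw [hl, hl, h.closeUp_other]
    · exact fun h' => h1 (fieldOf_injective h')
    · exact fun h' => h2 (fieldOf_injective (h'.trans e1.symm))
  · rw [hr, hr, h.compl.closeUp_other]
    · exact fun h' => h1 (fieldOf_injective h')
    · exact fun h' => h2 (fieldOf_injective (h'.trans e2.symm))
  · rw [hl, hr]; rfl
  · rw [hl, hr, e1, e2]

end Cut

end WickContraction
-- Existence of melons, and melon insertion as a connected sum
namespace WickContraction

theorem card_lt_of_not_mem {V : Type} [Finite V] {S : Set V} {v : V} (h : v ∉ S) :
    Nat.card S < Nat.card V :=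
  Finite.card_subtype_lt (p := fun t => t ∈ S) h

/-- A saturated contraction contains an elementary melon, none of whose five inner propagators
is the propagator at a given field. -/
theorem Saturated.exists_melon (n : ℕ) : ∀ (V : Type) [Finite V] (w : WickContraction V),
    w.graph.Connected → w.Saturated → Nat.card V = n → ∀ x : V × Fin 6,
    ∃ L R j, L ≠ R ∧ ∀ m, m ≠ j → w (L, m) = (R, m) ∧ x ≠ (L, m) ∧ x ≠ (R, m) := by
  -- The marked field makes the induction work: marking the propagator that closes up a region
  -- ensures that a melon found there is already present in `w`.
  induction n using Nat.strong_induction_on with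
  | _ n ih =>
  intro V _ w hw hs hn x
  obtain ⟨u, v, c, i, hJ, hi, hk⟩ := hs.exists_joinsPairs hw
  obtain ⟨Ψ, h1, h2, h3, h4, -⟩ := hs.exists_separations hw hJ
  replace h4 := h4 (by rw [hi])
  have huv := hJ.ne
  have hi' : w (v, i) = (u, i) := by rw [← hi, w.involutive]
  have hk' : w (v, partner c i) = (u, partner c i) := by rw [← hk, w.involutive]
  -- `T m` is the region behind label `m`; `P m` describes its fields together with the fields `m`
  -- of `u` and `v`.
  let T : Fin 6 → Set V := fun m => {t | t ≠ u ∧ t ≠ v ∧ Ψ t 0 = Ψ u m}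
  let P : Fin 6 → V × Fin 6 → Prop := fun m z =>
    Ψ z.1 z.2 = Ψ u m ∧ (z.1 = u ∨ z.1 = v → z.2 = m)
  have hPT : ∀ m z, z.1 ∈ T m → P m z := fun m z hz =>
    ⟨(h2 z.1 hz.1 hz.2.1 _ _).trans hz.2.2, fun h => absurd h (not_or.2 ⟨hz.1, hz.2.1⟩)⟩
  have hTP : ∀ m z, P m z → z.1 ≠ u → z.1 ≠ v → z.1 ∈ T m := fun m z hz hu hv =>
    ⟨hu, hv, (h2 z.1 hu hv _ _).trans hz.1⟩
  have hPw : ∀ m, m ≠ i → m ≠ partner c i → ∀ z, P m z → P m (w z) := by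
    intro m hm hm' z hz
    refine ⟨(h1 z).trans hz.1, fun hwz => ?_⟩
    have hz2 : ∀ n, (w z).2 = n → z = w ((w z).1, n) := fun n hn => by
      subst hn; exact (w.involutive z).symm
    have n1 : (w z).2 ≠ i := fun h => by
      have := hz2 _ h
      rcases hwz with hwz | hwz <;> rw [hwz] at this
      · rw [hi] at this
        exact hm ((hz.2 (Or.inr (by rw [this]))).symm.trans (by rw [this]))
      · rw [hi'] at this
        exact hm ((hz.2 (Or.inl (by rw [this]))).symm.trans (by rw [this]))
    have n2 : (w z).2 ≠ partner c i := fun h => by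
      have := hz2 _ h
      rcases hwz with hwz | hwz <;> rw [hwz] at this
      · rw [hk] at this
        exact hm' ((hz.2 (Or.inr (by rw [this]))).symm.trans (by rw [this]))
      · rw [hk'] at this
        exact hm' ((hz.2 (Or.inl (by rw [this]))).symm.trans (by rw [this]))
    refine h3 _ _ n1 n2 hm hm' ?_
    rw [← hz.1, ← h1 z]
    rcases hwz with hwz | hwz <;> rw [hwz]
    rw [h4]
  have hcut : ∀ m, m ≠ i → m ≠ partner c i → w (u, m) ≠ (v, m) →
      w.IsCut (T m) (w (u, m)) (w (v, m)) := by
    intro m hm hm' hne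
    have pu : P m (w (u, m)) := hPw m hm hm' _ ⟨rfl, fun _ => rfl⟩
    have pv : P m (w (v, m)) := hPw m hm hm' _ ⟨h4 m, fun _ => rfl⟩
    refine
      { ne := fun h => huv (congrArg Prod.fst (w.involutive.injective h))
        left_mem := hTP m _ pu (fun h => ?_) fun h => ?_
        right_mem := hTP m _ pv (fun h => ?_) fun h => ?_
        left_not_mem := by rw [w.involutive]; exact fun h => h.1 rfl
        right_not_mem := by rw [w.involutive]; exact fun h => h.2.1 rfl
        mem := fun z hz hzu hzv => ?_ }
    · exact w.ne_self (u, m) (Prod.ext h (pu.2 (Or.inl h)))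
    · exact hne (Prod.ext h (pu.2 (Or.inr h)))
    · refine hne ?_
      rw [← w.involutive (v, m)]
      exact congrArg _ (Prod.ext h (pv.2 (Or.inl h))).symm
    · exact w.ne_self (v, m) (Prod.ext h (pv.2 (Or.inr h)))
    · have pz := hPw m hm hm' z (hPT m z hz)
      refine hTP m _ pz (fun h => hzu ?_) fun h => hzv ?_
      · rw [← (Prod.ext h (pz.2 (Or.inl h)) : w z = (u, m)), w.involutive]
      · rw [← (Prod.ext h (pz.2 (Or.inr h)) : w z = (v, m)), w.involutive]
  -- If some region does not contain the whole marked propagator, the induction hypothesis applies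
  -- to that region, and a melon inside it avoids `x`.
  by_cases hA : ∃ m, m ≠ i ∧ m ≠ partner c i ∧ w (u, m) ≠ (v, m) ∧
      ¬ (x.1 ∈ T m ∧ (w x).1 ∈ T m)
  · obtain ⟨m, hm, hm', hne, hx⟩ := hA
    have hc := hcut m hm hm' hne
    have hcard : Nat.card (T m) < n := hn ▸ card_lt_of_not_mem (v := u) fun h => h.1 rfl
    have conn₁ := hc.isSum.connected_left hw
    have conn₂ := hc.isSum.symm.connected_left hw
    obtain ⟨L, R, j, hLR, hmel⟩ := ih _ hcard (T m) hc.closeUp conn₁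
      (hc.isSum.saturated_left conn₁ conn₂ hs) rfl (⟨_, hc.left_mem⟩, (w (u, m)).2)
    refine ⟨L, R, j, fun h => hLR (Subtype.ext h), fun l hl => ?_⟩
    obtain ⟨e, nL, nR⟩ := hmel l hl
    have hw' : w (L.1, l) = (R.1, l) := by
      have := hc.closeUp_other (z := (L, l)) (fun h => nL (fieldOf_injective h.symm)) (fun h => ?_)
      · rw [e] at this; exact this.symm
      · have := hc.closeUp_right h
        rw [e] at this
        exact nR (fieldOf_injective this.symm)
    refine ⟨hw', fun h => hx ?_, fun h => hx ?_⟩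
    · rw [h, hw']; exact ⟨L.2, R.2⟩
    · rw [h, ← hw', w.involutive, hw']; exact ⟨R.2, L.2⟩
  -- Now every region contains the marked propagator. Regions of different labels are disjoint, so
  -- at most one label of `u` and `v` is not directly joined, and `u`, `v` form the melon.
  · push Not at hA
    by_cases hB : ∃ m, m ≠ i ∧ m ≠ partner c i ∧ w (u, m) ≠ (v, m)
    · obtain ⟨m, hm, hm', hne⟩ := hB
      have hx := (hA m hm hm' hne).1
      refine ⟨u, v, m, huv, fun l hl => ⟨?_, fun h => hx.1 (by rw [h]), fun h => hx.2.1 (by rw [h])⟩⟩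
      by_cases hl1 : l = i
      · rw [hl1, hi]
      by_cases hl2 : l = partner c i
      · rw [hl2, hk]
      by_contra hne'
      have hx' := (hA l hl1 hl2 hne').1
      exact hl (h3 l m hl1 hl2 hm hm' (hx'.2.2.symm.trans hx.2.2))
    · push Not at hB
      -- All six labels are joined directly, so any label may be external; `x.2` keeps `x` off the
      -- inner propagators.
      refine ⟨u, v, x.2, huv, fun l hl => ⟨?_, fun h => hl (by rw [h]), fun h => hl (by rw [h])⟩⟩
      by_cases hl1 : l = i
      · rw [hl1, hi]
      by_cases hl2 : l = partner c i
      · rw [hl2, hk]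
      exact hB l hl1 hl2

theorem partner_fpf (c : Fin 4) : FPFInvolution (partner c) :=
  ⟨partner_partner c, partner_ne c⟩

/-- The two-vertex diagram in which equally labelled fields are joined is saturated. -/
theorem saturated_of_twoVertex {V : Type} [Finite V] (w : WickContraction V) (e : Bool ≃ V)
    (h : ∀ b i, w (e b, i) = (e (!b), i)) : w.Saturated := by
  have hV : Nat.card V = 2 := by rw [← Nat.card_congr e]; simp
  have h2 : ∀ x, (w x).2 = x.2 := fun x => by
    have := h (e.symm x.1) x.2
    rw [e.apply_symm_apply] at this
    rw [show x = (x.1, x.2) from rfl, this]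
  have hc : ∀ c, w.loopsOfColour c = 3 := fun c => by
    have : Nat.card (Orb w.toFun (contract c)) = Nat.card (Orb (partner c) (partner c)) :=
      Nat.card_congr
        { toFun := Quot.lift (fun x => orb (partner c) (partner c) x.2) (by
            rintro x y (rfl | rfl)
            · rw [h2]
            · exact (orb_right (b := partner c) x.2).symm)
          invFun := Quot.lift (fun i => orb w.toFun (contract c) (e false, i)) (by
            rintro i j (rfl | rfl) <;>
              exact (orb_right (a := w.toFun) (b := contract c) (e false, i)).symm)
          left_inv := fun q => by
            induction q using Quot.ind with
            | mk x =>
              obtain ⟨v, i⟩ := x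
              obtain ⟨b, rfl⟩ := e.surjective v
              cases b
              · rfl
              · change orb _ _ (e false, i) = orb _ _ (e true, i)
                rw [← orb_left (a := w.toFun) (b := contract c) (e true, i), h true i]
                rfl
          right_inv := fun q => by
            induction q using Quot.ind with
            | mk x => rfl }
    have := Fintype.ofFinite (Orb (partner c) (partner c))
    have h3 := two_mul_card_orb_self (partner_fpf c)
    rw [Fintype.card_fin, ← Nat.card_eq_fintype_card] at h3
    change Nat.card (Orb w.toFun (contract c)) = 3
    omega
  simp [Saturated, hc, hV]

/-- The two-vertex diagram in which equally labelled fields are joined. -/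
def twoVertex : WickContraction Bool where
  toFun x := (!x.1, x.2)
  involutive x := by simp
  ne_self x h := by simpa using congrArg Prod.fst h

/-- Inserting an elementary melon is a connected sum with the two-vertex diagram. -/
theorem IsMelonInsertion.isSum {V V' : Type} {w : WickContraction V} {w' : WickContraction V'}
    {x : V × Fin 6} {j : Fin 6} {e : V ⊕ Bool ≃ V'} (h : w.IsMelonInsertion w' x j e) :
    IsSum w twoVertex w' x (false, j) e where
  left z h1 h2 := h.other z h1 h2
  right := by
    rintro ⟨b, i⟩ h1 h2
    have hij : i ≠ j := by
      rintro rfl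
      cases b
      · exact h1 rfl
      · exact h2 rfl
    cases b
    · exact h.inner i hij
    · exact (w'.involutive.eq_iff.1 (h.inner i hij)).symm
  base := (w'.involutive.eq_iff.1 h.left).symm
  base' := (w'.involutive.eq_iff.1 h.right).symm

theorem IsMelonInsertion.saturated {V V' : Type} [Finite V] {w : WickContraction V}
    {w' : WickContraction V'} {x : V × Fin 6} {j : Fin 6} {e : V ⊕ Bool ≃ V'}
    (h : w.IsMelonInsertion w' x j e) (hs : w.Saturated) : w'.Saturated :=
  h.isSum.saturated hs (saturated_of_twoVertex _ (Equiv.refl Bool) fun _ _ => rfl)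

end WickContraction

/-! ### Maximal diagrams are the melonic ones -/

namespace VacuumDiagram

open WickContraction

theorem loops_le (D : VacuumDiagram) : D.loops ≤ 4 * D.order + 4 := by
  cases D with
  | zeroCycle => exact le_rfl
  | ofContraction V w conn => exact sum_loopsOfColour_le conn

theorem IsMaximal.not_hasOneCycle {D : VacuumDiagram} (h : D.IsMaximal) : ¬ D.HasOneCycle := by
  cases D with
  | zeroCycle => exact id
  | ofContraction V w conn =>
    rintro ⟨v, i, j, hv⟩
    exact Saturated.ne_oneCycle h conn v i j hv

theorem MelonMove.isMaximal {D D' : VacuumDiagram} (h : MelonMove D D') (hD : D.IsMaximal) :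
    D'.IsMaximal := by
  cases h with
  | onZeroCycle w conn e h => exact saturated_of_twoVertex w e h
  | onPropagator w conn w' conn' x j e h => exact h.saturated hD

theorem IsMelonic.isMaximal {D : VacuumDiagram} (h : D.IsMelonic) : D.IsMaximal := by
  induction h with
  | refl => rfl
  | tail _ hm ih => exact hm.isMaximal ih

theorem isMelonic_of_saturated (n : ℕ) : ∀ (V : Type) [Finite V] (w : WickContraction V)
    (conn : w.graph.Connected), w.Saturated → Nat.card V = n →
    (ofContraction V w conn).IsMelonic := by
  induction n using Nat.strong_induction_on with
  | _ n ih =>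
  intro V _ w hw hs hn
  have := hw.nonempty
  -- No propagator has to be avoided here, so the marked field is arbitrary.
  obtain ⟨L, R, j, hLR, hmel⟩ := hs.exists_melon n V w hw hn (Classical.arbitrary V, 0)
  replace hmel := fun m hm => (hmel m hm).1
  have hmel' : ∀ m, m ≠ j → w (R, m) = (L, m) := fun m hm => by rw [← hmel m hm, w.involutive]
  by_cases hj : w (L, j) = (R, j)
  · have all : ∀ m, w (L, m) = (R, m) := fun m => by
      by_cases hm : m = j
      · rw [hm, hj]
      · exact hmel m hm
    have all' : ∀ m, w (R, m) = (L, m) := fun m => by rw [← all m, w.involutive]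
    have hmem := (w.connected_iff.1 hw).2 {L, R} ⟨L, Or.inl rfl⟩ (by
      rintro ⟨t, m⟩ (rfl | rfl)
      · rw [all]; exact Or.inr rfl
      · rw [all']; exact Or.inl rfl)
    let e : Bool ≃ V := Equiv.ofBijective (fun b => cond b R L) (by
      constructor
      · rintro (_ | _) (_ | _) h
        · rfl
        · exact absurd h hLR
        · exact absurd h.symm hLR
        · rfl
      · intro t
        rcases hmem t with rfl | rfl
        · exact ⟨false, rfl⟩
        · exact ⟨true, rfl⟩)
    refine Relation.ReflTransGen.single (MelonMove.onZeroCycle w hw e ?_)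
    rintro (_ | _) m
    · exact all m
    · exact all' m
  -- The external fields leave `{L, R}`: a 1-cycle is excluded, and the other labels of `L` and `R`
  -- are already paired. Hence the melon can be cut off and its complement closed up to a smaller
  -- saturated diagram.
  · have hLS : (w (L, j)).1 ∉ ({L, R} : Set V) := by
      have hcases : ∀ t m, w (L, j) = (t, m) → t ∉ ({L, R} : Set V) := by
        rintro t m h (rfl | rfl)
        · exact hs.ne_oneCycle hw _ _ _ h
        · by_cases hm : m = j
          · exact hj (hm ▸ h)
          · have := hmel m hm
            rw [← h] at this
            exact hm (congrArg Prod.snd (w.involutive.injective this))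
      exact hcases _ _ rfl
    have hRS : (w (R, j)).1 ∉ ({L, R} : Set V) := by
      have hcases : ∀ t m, w (R, j) = (t, m) → t ∉ ({L, R} : Set V) := by
        rintro t m h (rfl | rfl)
        · by_cases hm : m = j
          · exact hj (by rw [← hm, ← h, w.involutive, hm])
          · have := hmel' m hm
            rw [← h] at this
            exact hm (congrArg Prod.snd (w.involutive.injective this))
        · exact hs.ne_oneCycle hw _ _ _ h
      exact hcases _ _ rfl
    have hc : w.IsCut {L, R} (L, j) (R, j) :=
      { ne := fun h => hLR (congrArg Prod.fst h)
        left_mem := Or.inl rfl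
        right_mem := Or.inr rfl
        left_not_mem := hLS
        right_not_mem := hRS
        mem := by
          rintro ⟨t, m⟩ (rfl | rfl) h1 h2
          · rw [hmel m fun h => h1 (by rw [h])]; exact Or.inr rfl
          · rw [hmel' m fun h => h2 (by rw [h])]; exact Or.inl rfl }
    have conn₁ := hc.isSum.connected_left hw
    have conn₂ := hc.isSum.symm.connected_left hw
    have hs₂ := hc.isSum.symm.saturated_left conn₂ conn₁ hs
    have hcard : Nat.card (({L, R} : Set V)ᶜ : Set V) < n :=
      hn ▸ card_lt_of_not_mem (v := L) fun h => h (Or.inl rfl)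
    refine (ih _ hcard _ _ conn₂ hs₂ rfl).tail ?_
    let e : (({L, R} : Set V)ᶜ : Set V) ⊕ Bool ≃ V :=
      Equiv.ofBijective (Sum.elim Subtype.val fun b => cond b R L) (by
        constructor
        · rintro (s | _ | _) (t | _ | _) h
          · exact congrArg Sum.inl (Subtype.ext h)
          · exact absurd (Or.inl h) s.2
          · exact absurd (Or.inr h) s.2
          · exact absurd (Or.inl h.symm) t.2
          · rfl
          · exact absurd h hLR
          · exact absurd (Or.inr h.symm) t.2
          · exact absurd h.symm hLR
          · rfl
        · intro t
          by_cases ht : t ∈ ({L, R} : Set V)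
          · rcases ht with rfl | rfl
            · exact ⟨Sum.inr false, rfl⟩
            · exact ⟨Sum.inr true, rfl⟩
          · exact ⟨Sum.inl ⟨t, ht⟩, rfl⟩)
    have hx := hc.compl.closeUp_left (z := (⟨_, hLS⟩, (w (L, j)).2)) rfl
    refine MelonMove.onPropagator hc.compl.closeUp conn₂ w hw (⟨_, hLS⟩, (w (L, j)).2) j e
      { inner := fun m hm => hmel m hm
        left := rfl
        right := hx.symm
        other := fun y h1 h2 => ?_ }
    exact (hc.compl.closeUp_other (fun h => h1 (fieldOf_injective h))
      (fun h => h2 (fieldOf_injective (h.trans hx.symm)))).symm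

theorem isMaximal_iff_isMelonic (D : VacuumDiagram) : D.IsMaximal ↔ D.IsMelonic := by
  refine ⟨fun h => ?_, IsMelonic.isMaximal⟩
  cases D with
  | zeroCycle => exact Relation.ReflTransGen.refl
  | ofContraction V w conn => exact isMelonic_of_saturated _ V w conn h rfl

end VacuumDiagram

end OctahedronModel

theorem mainTheorem6 :
    (∀ D : OctahedronModel.VacuumDiagram, D.loops ≤ 4 * D.order + 4) ∧
    (∀ D : OctahedronModel.VacuumDiagram, D.IsMaximal → ¬ D.HasOneCycle) ∧
    (∀ D : OctahedronModel.VacuumDiagram, D.IsMaximal ↔ D.IsMelonic) :=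
  ⟨OctahedronModel.VacuumDiagram.loops_le, fun _ h => h.not_hasOneCycle,
    OctahedronModel.VacuumDiagram.isMaximal_iff_isMelonic⟩
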